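/- For $n\ge 2$ let $G=\mathrm{SL}_n(\mathbb R)$, $\Gamma=\mathrm{SL}_n(\mathbb Z)$ (acting on $G$ by left translations), $K=\mathrm{SO}_n$, let $A$ be the group of diagonal matrices $a=\mathrm{diag}(a_1,\dots,a_n)$ in $G$ with all $a_i>0$, and $N$ the group of upper triangular unipotent matrices $u=(u_{ij})$. Let $\mathrm{vol}$ be the measure on $G$ given in the Iwasawa coordinates $g=kau$ ($k\in K$, $a\in A$, $u\in N$) by $$dg=\prod_{i<j}\frac{a_i}{a_j}\;dk\,da\,du,\qquad da=\prod_{i=1}^{n-1}\frac{da_i}{a_i},\qquad du=\prod_{i<j}du_{ij},$$ where $dk$ is the Haar measure on $K$ of total mass $$\mathrm{vol}(\mathrm{SO}_n)=\prod_{i=2}^{n}2^{\frac{i-1}{2}}\,\mathrm{vol}(\mathbb S^{i-1}),\qquad \mathrm{vol}(\mathbb S^{i-1})=\frac{2\pi^{i/2}}{\Gamma(i/2)}.$$ Denote by $\mathrm{vol}(\Gamma\backslash G)$ the volume of a measurable fundamental domain for the action of $\Gamma$ on $G$. For $t,\lambda>0$ let $\Sigma_{t,\lambda}=K A_t N_\lambda$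 be the Siegel set, where $$A_t=\{a\in A:\ a_i/a_{i+1}\le t\ \text{ for } 1\le i\le n-1\},\qquad N_\lambda=\{u\in N:\ |u_{ij}|\le\lambda\ \text{ for } i<j\},$$ and put $\Sigma^{(n)}=\Sigma_{2/\sqrt3,\,1/2}\subset \mathrm{SL}_n(\mathbb R)$. Then, for every $n\ge2$, $\mathrm{vol}$ is a Haar measure on $G$, a measurable fundamental domain for $\Gamma$ exists, and $\Gamma\backslash G$ has finite volume, with $$\mathrm{vol}(\Gamma\backslash G)\le \mathrm{vol}(\Sigma^{(n)})<\infty .$$ Moreover there is a constant $c>0$, independent of $n$, such that $\mathrm{vol}(\Sigma^{(n)})$ grows like $e^{cn^3}$ on the logarithmic scale, i.e. $$\lim_{n\to\infty}\frac{\log \mathrm{vol}(\Sigma^{(n)})}{n^3}=c,$$ and $\mathrm{vol}(\Gamma\backslash G)\prec e^{cn^3}$ as $n\to\infty$; that is, there is a constant $C>0$ with $\mathrm{vol}(\mathrm{SL}_n(\mathbb Z)\backslash \mathrm{SL}_n(\mathbb R))\le C e^{cn^3}$ for all sufficiently large $n$. -/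

import Mathlib

namespace SLVolume

open MeasureTheory Matrix
open scoped Pointwise

/-- The group `SL_n(ℝ)`, with its topology as a subspace of the `n × n` matrices. -/
abbrev G (n : ℕ) : Type := Matrix.SpecialLinearGroup (Fin n) ℝ

/-- `SL_n(ℝ)` carries its Borel σ-algebra. -/
instance instMeasurableSpaceG (n : ℕ) : MeasurableSpace (G n) := borel (G n)

instance instBorelSpaceG (n : ℕ) : BorelSpace (G n) := ⟨rfl⟩

/-- `SL_n(ℤ)` as a subgroup of `SL_n(ℝ)`; it acts on `SL_n(ℝ)` by left translations. -/
def Gam (n : ℕ) : Subgroup (G n) :=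
  (Matrix.SpecialLinearGroup.map (n := Fin n) (Int.castRingHom ℝ)).range

/-- The compact group `K = SO_n` as a subgroup of `SL_n(ℝ)`. -/
def K (n : ℕ) : Subgroup (G n) where
  carrier := {g | (g : Matrix (Fin n) (Fin n) ℝ) ∈ Matrix.orthogonalGroup (Fin n) ℝ}
  mul_mem' := by
    intro a b ha hb
    simp only [Set.mem_ofPred_eq, Matrix.SpecialLinearGroup.coe_mul] at *
    exact mul_mem ha hb
  one_mem' := by
    simp only [Set.mem_ofPred_eq, Matrix.SpecialLinearGroup.coe_one]
    exact one_mem _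
  inv_mem' := by
    intro a ha
    simp only [Set.mem_ofPred_eq] at *
    have h1 : star (a : Matrix (Fin n) (Fin n) ℝ) * a = 1 := Unitary.star_mul_self_of_mem ha
    have h2 : (a : Matrix (Fin n) (Fin n) ℝ) * ((a⁻¹ : G n) : Matrix (Fin n) (Fin n) ℝ) = 1 := by
      rw [← Matrix.SpecialLinearGroup.coe_mul, mul_inv_cancel, Matrix.SpecialLinearGroup.coe_one]
    have h3 : ((a⁻¹ : G n) : Matrix (Fin n) (Fin n) ℝ)
        = star (a : Matrix (Fin n) (Fin n) ℝ) := (left_inv_eq_right_inv h1 h2).symm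
    rw [h3]
    exact Unitary.star_mem ha

instance instCompactSpaceK (n : ℕ) : CompactSpace (K n) := by
  refine isCompact_iff_compactSpace.1 (?_ : IsCompact ((K n : Subgroup (G n)) : Set (G n)))
  have hemb : Topology.IsClosedEmbedding
      ((↑) : G n → Matrix (Fin n) (Fin n) ℝ) :=
    Matrix.SpecialLinearGroup.isClosedEmbedding_val
  have hbox : IsCompact (Set.pi Set.univ fun _ : Fin n =>
      Set.pi Set.univ fun _ : Fin n => Set.Icc (-1 : ℝ) 1) :=
    isCompact_univ_pi fun _ => isCompact_univ_pi fun _ => isCompact_Icc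
  refine (hemb.isCompact_preimage hbox).of_isClosed_subset ?_ ?_
  · have : ((K n : Subgroup (G n)) : Set (G n)) = {g : G n |
        (g : Matrix (Fin n) (Fin n) ℝ) * (g : Matrix (Fin n) (Fin n) ℝ)ᵀ = 1} := by
      ext g
      exact Matrix.mem_orthogonalGroup_iff (Fin n) ℝ
    rw [this]
    exact isClosed_eq (hemb.continuous.mul hemb.continuous.matrix_transpose) continuous_const
  · intro g hg i _ j _
    have := entry_norm_bound_of_unitary (𝕜 := ℝ) (U := (g : Matrix (Fin n) (Fin n) ℝ)) hg i j
    exact abs_le.1 this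

/-- The volume of the unit sphere `S^{i-1} ⊂ ℝ^i`. -/
noncomputable def sphereVol (i : ℕ) : ℝ :=
  2 * Real.pi ^ ((i : ℝ) / 2) / Real.Gamma ((i : ℝ) / 2)

/-- `vol(SO_n) = ∏_{i=2}^n 2^{(i-1)/2} vol(S^{i-1})`. -/
noncomputable def volSO (n : ℕ) : ℝ :=
  ∏ i ∈ Finset.Icc 2 n, (2 : ℝ) ^ (((i : ℝ) - 1) / 2) * sphereVol i

/-- The Haar measure `dk` on `K = SO_n`, normalised to have total mass `vol(SO_n)`. -/
noncomputable def muK (n : ℕ) : Measure (K n) :=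
  ENNReal.ofReal (volSO n) • Measure.haarMeasure (⊤ : TopologicalSpace.PositiveCompacts (K n))

/-- The diagonal entries `a_1, …, a_n` in terms of `t_i = log a_i` for `1 ≤ i ≤ n - 1`; the last one
is `a_n = (a_1 ⋯ a_{n-1})⁻¹`. -/
noncomputable def diagEntry (n : ℕ) (t : Fin (n - 1) → ℝ) (i : Fin n) : ℝ :=
  if h : (i : ℕ) < n - 1 then Real.exp (t ⟨i, h⟩) else Real.exp (-∑ j, t j)

theorem prod_diagEntry (n : ℕ) (t : Fin (n - 1) → ℝ) : ∏ i, diagEntry n t i = 1 := by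
  cases n with
  | zero => simp
  | succ m =>
    rw [Fin.prod_univ_castSucc]
    have h1 : ∀ i : Fin m, diagEntry (m + 1) t i.castSucc = Real.exp (t i) := by
      intro i
      simp [diagEntry]
    have h2 : diagEntry (m + 1) t (Fin.last m) = Real.exp (-∑ j, t j) := by
      simp [diagEntry]
    rw [Finset.prod_congr rfl fun i _ => h1 i, h2, ← Real.exp_sum, ← Real.exp_add]
    exact Real.exp_eq_one_iff _ |>.2 (add_neg_cancel _)

/-- The element `diag(a_1, …, a_n)` of `A` with `log a_i = t_i` for `i < n`. -/
noncomputable def matA (n : ℕ) (t : Fin (n - 1) → ℝ) : G n :=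
  ⟨Matrix.diagonal (diagEntry n t), by rw [Matrix.det_diagonal, prod_diagEntry]⟩

/-- The positions strictly above the diagonal. -/
abbrev Upper (n : ℕ) : Type := {p : Fin n × Fin n // p.1 < p.2}

/-- The upper triangular unipotent matrix with entries `u_{ij}`, `i < j`, above the diagonal. -/
def matN (n : ℕ) (u : Upper n → ℝ) : G n :=
  ⟨Matrix.of fun i j => if h : i < j then u ⟨(i, j), h⟩ else if i = j then 1 else 0, by
    rw [Matrix.det_of_isUpperTriangular]
    · simp
    · intro i j hij
      have hij' : j < i := hij
      simp [hij'.not_gt, hij'.ne']⟩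

/-- The density `∏_{i<j} a_i / a_j`. -/
noncomputable def density (n : ℕ) (t : Fin (n - 1) → ℝ) : ℝ :=
  ∏ p : Upper n, diagEntry n t p.1.1 / diagEntry n t p.1.2

/-- The measure on `SL_n(ℝ)` given in the Iwasawa coordinates `g = k a u` by
`dg = ∏_{i<j} (a_i / a_j) dk da du`, where `dk` has total mass `vol(SO_n)`,
`da = ∏_{i<n} da_i / a_i = ∏_{i<n} dt_i` and `du = ∏_{i<j} du_{ij}`. -/
noncomputable def vol (n : ℕ) : Measure (G n) :=
  ((muK n).prod
    (((volume : Measure (Fin (n - 1) → ℝ)).withDensity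
        fun t => ENNReal.ofReal (density n t)).prod
      (volume : Measure (Upper n → ℝ)))).map
    fun x => (x.1 : G n) * matA n x.2.1 * matN n x.2.2

/-- `A_t`: positive diagonal matrices of determinant one with `a_i / a_{i+1} ≤ t`. -/
def siegelA (n : ℕ) (t : ℝ) : Set (G n) :=
  {a | ∃ d : Fin n → ℝ, (∀ i, 0 < d i) ∧
    (a : Matrix (Fin n) (Fin n) ℝ) = Matrix.diagonal d ∧
    ∀ i j : Fin n, (j : ℕ) = (i : ℕ) + 1 → d i / d j ≤ t}

/-- `N_l`: upper triangular unipotent matrices with `|u_{ij}| ≤ l` for `i < j`. -/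
def siegelN (n : ℕ) (l : ℝ) : Set (G n) :=
  {u | (∀ i, u i i = 1) ∧ (∀ i j, j < i → u i j = 0) ∧ ∀ i j, i < j → |u i j| ≤ l}

/-- The Siegel set `Σ_{t,l} = K A_t N_l`. -/
def siegel (n : ℕ) (t l : ℝ) : Set (G n) :=
  (K n : Set (G n)) * siegelA n t * siegelN n l

/-- The volume of `SL_n(ℤ) \ SL_n(ℝ)`. -/
noncomputable def quotVol (n : ℕ) : ENNReal := covolume (Gam n) (G n) (vol n)

end SLVolume

/-!
The proof compares a fundamental domain of `SL_n(ℤ)` with the Siegel set `Σ`, whose volume is an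
explicit product.

*Haar measure.* Let `B = AN`. The Iwasawa measure `vol` is left `K`-invariant by construction and
right `B`-invariant because the density `∏_{i<j} a_i / a_j` compensates the Jacobian of conjugation
by `A` on `N` (`vol_map_left`, `vol_map_right`). The group `K × B` acts simply transitively on
`SL_n(ℝ)` by `g ↦ k g b⁻¹`, so uniqueness of Haar measure on `K × B` leaves only one such measure up
to scaling (`eq_smul_of_invariant`). Another one is the cone measure
`E ↦ Lebesgue {s g | g ∈ E, 0 < s ≤ 1}`, which is visibly invariant under both left and right
translations since these have determinant one on matrices. Hence `vol` is a multiple of the cone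
measure; in particular it is a bi-invariant Haar measure, and therefore invariant under `g ↦ g⁻¹`.

*Reduction theory.* Every `g` has some `γ ∈ SL_n(ℤ)` with `g γ ∈ Σ` (`exists_mul_mem_siegel`). In
terms of the Gram matrix `gᵀ g` this is Hermite's reduction of positive definite forms
(`exists_reduced_congruence`): make the upper left entry minimal in the `SL_n(ℤ)`-orbit, reduce its
Schur complement recursively, and round the first row of `u`; minimality gives the bound
`d_0 ≤ d_0 / 4 + d_1`. Thus `Σ⁻¹` meets every orbit of left translations, and the volume of the
quotient is at most `vol(Σ⁻¹) = vol(Σ)`. A Borel fundamental domain exists because `SL_n(ℤ)` is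
discrete (`exists_isFundamentalDomain`).

*The volume of `Σ`.* In the coordinates `s_k = log (a_k / a_{k+1})` on `A`, which have Jacobian `n`
with respect to `log a_1, …, log a_{n-1}`, the density is `∏_k exp (k (n - k) s_k)`. The integral
over `s_k ≤ log (2/√3)` gives (`vol_siegel`)
`vol(Σ) = vol(SO_n) · n⁻¹ · ∏_{k<n} (2/√3)^{k(n-k)} / (k(n-k))`.
As `∑_k k (n - k) = (n³ - n) / 6`, and the other factors contribute only `O(n² log n)` to the
logarithm, the limit is `c = log (2/√3) / 6`. The factors of `vol(SO_n)` are bounded by a constant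
`R`, so the product of the other factors is at most `R^{n-1} / (n-1)! ≤ e^R`, which gives the upper
bound with the same `c`.
-/

namespace SLVolume

open MeasureTheory Matrix
open scoped Pointwise

/-! ### Reduction of positive definite forms -/

/-- The matrix `[[c, x], [0, M]]` obtained by bordering `M` with a new first row and column. -/
def border {R : Type*} [Zero R] {n : ℕ} (c : R) (x : Fin n → R) (M : Matrix (Fin n) (Fin n) R) :
    Matrix (Fin (n + 1)) (Fin (n + 1)) R :=
  Matrix.of (Fin.cons (Fin.cons c x) fun i => Fin.cons 0 (M i))

section border

variable {R : Type*} [CommRing R] {n : ℕ} (c : R) (x : Fin n → R) (M : Matrix (Fin n) (Fin n) R)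

@[simp] theorem border_zero_zero : border c x M 0 0 = c := rfl

@[simp] theorem border_zero_succ (j : Fin n) : border c x M 0 j.succ = x j := rfl

@[simp] theorem border_succ_zero (i : Fin n) : border c x M i.succ 0 = 0 := rfl

@[simp] theorem border_succ_succ (i j : Fin n) : border c x M i.succ j.succ = M i j := rfl

theorem det_border : (border c x M).det = c * M.det := by
  rw [Matrix.det_succ_column_zero, Fin.sum_univ_succ]
  simp only [border_succ_zero, mul_zero, zero_mul, Finset.sum_const_zero, add_zero]
  have : (border c x M).submatrix (Fin.succAbove 0) Fin.succ = M := by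
    ext i j; simp
  rw [this]
  simp

theorem border_mul (c' : R) (x' : Fin n → R) (M' : Matrix (Fin n) (Fin n) R) :
    border c x M * border c' x' M' =
      border (c * c') (c • x' + x ᵥ* M') (M * M') := by
  ext i j
  refine Fin.cases ?_ (fun i => ?_) i <;> refine Fin.cases ?_ (fun j => ?_) j <;>
    simp [Matrix.mul_apply, Fin.sum_univ_succ, Matrix.vecMul, dotProduct]

theorem border_map {S : Type*} [CommRing S] (f : R →+* S) :
    (border c x M).map f = border (f c) (fun j => f (x j)) (M.map f) := by
  ext i j
  refine Fin.cases ?_ (fun i => ?_) i <;> refine Fin.cases ?_ (fun j => ?_) j <;> simp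

/-- The congruence `(1 y; 0 A)ᵀ diag(s, T) (1 y; 0 A)` depends on `A` and `T` only through
`Aᵀ T A`. -/
theorem border_congruence (s : R) (y : Fin n → R) {A T B T' : Matrix (Fin n) (Fin n) R}
    (h : Aᵀ * T * A = Bᵀ * T' * B) :
    (border 1 y A)ᵀ * border s 0 T * border 1 y A =
      (border 1 y B)ᵀ * border s 0 T' * border 1 y B := by
  ext i j
  refine Fin.cases ?_ (fun i => ?_) i <;> refine Fin.cases ?_ (fun j => ?_) j
  · simp [Matrix.mul_apply, Fin.sum_univ_succ]
  · simp [Matrix.mul_apply, Fin.sum_univ_succ]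
  · simp [Matrix.mul_apply, Fin.sum_univ_succ]
  · have := congrFun (congrFun h i) j
    simp only [Matrix.mul_apply, Matrix.transpose_apply] at this
    simp [Matrix.mul_apply, Fin.sum_univ_succ, this]

theorem border_diagonal (d : Fin n → R) :
    border c 0 (Matrix.diagonal d) = Matrix.diagonal (Fin.cons c d : Fin (n + 1) → R) := by
  ext i j
  refine Fin.cases ?_ (fun i => ?_) i <;> refine Fin.cases ?_ (fun j => ?_) j
  · simp
  · simp [(Fin.succ_ne_zero _).symm]
  · simp
  · simp [Matrix.diagonal_apply]

end border

/-- The Schur complement of the upper left entry of a matrix. -/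
noncomputable def schur {n : ℕ} (S : Matrix (Fin (n + 1)) (Fin (n + 1)) ℝ) :
    Matrix (Fin n) (Fin n) ℝ :=
  Matrix.of fun i j => S i.succ j.succ - S i.succ 0 * S 0 j.succ / S 0 0

theorem eq_border_schur {n : ℕ} {S : Matrix (Fin (n + 1)) (Fin (n + 1)) ℝ} (hS : S.PosDef) :
    S = (border 1 (fun j => S 0 j.succ / S 0 0) 1)ᵀ * border (S 0 0) 0 (schur S) *
      border 1 (fun j => S 0 j.succ / S 0 0) 1 := by
  have h0 : S 0 0 ≠ 0 := hS.diag_pos.ne'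
  have hsymm : ∀ i j, S i j = S j i := fun i j => by simpa using (hS.1.apply i j).symm
  ext i j
  refine Fin.cases ?_ (fun i => ?_) i <;> refine Fin.cases ?_ (fun j => ?_) j
  · simp [Matrix.mul_apply, Fin.sum_univ_succ]
  · simp [Matrix.mul_apply, Fin.sum_univ_succ]
    field_simp
  · simp [Matrix.mul_apply, Fin.sum_univ_succ, hsymm i.succ 0]
    field_simp
  · simp [Matrix.mul_apply, Fin.sum_univ_succ, schur, Matrix.one_apply, hsymm i.succ 0]
    field_simp
    ring

theorem posDef_congruence {n : ℕ} {S : Matrix (Fin n) (Fin n) ℝ} (hS : S.PosDef)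
    {A : Matrix (Fin n) (Fin n) ℝ} (hA : IsUnit A.det) : (Aᵀ * S * A).PosDef := by
  have := hS.conjTranspose_mul_mul_same (B := A)
    (Matrix.mulVec_injective_of_isUnit ((Matrix.isUnit_iff_isUnit_det A).2 hA))
  rwa [Matrix.conjTranspose_eq_transpose_of_trivial] at this

theorem posDef_schur {n : ℕ} {S : Matrix (Fin (n + 1)) (Fin (n + 1)) ℝ} (hS : S.PosDef) :
    (schur S).PosDef := by
  have h := eq_border_schur hS
  set x : Fin n → ℝ := fun j => S 0 j.succ / S 0 0
  have hinv : border 1 x 1 * border 1 (-x) 1 = (1 : Matrix (Fin (n + 1)) (Fin (n + 1)) ℝ) := by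
    rw [border_mul, ← Matrix.diagonal_one, ← Matrix.diagonal_one]
    simp only [Matrix.diagonal_one, Matrix.vecMul_one, one_smul, neg_add_cancel, mul_one]
    rw [← Matrix.diagonal_one, border_diagonal]
    congr 1
    ext i; refine Fin.cases ?_ (fun i => ?_) i <;> simp
  have h1 : (border 1 (-x) 1)ᵀ * S * border 1 (-x) 1 = border (S 0 0) 0 (schur S) := by
    have h2 : (border 1 (-x) 1)ᵀ * S * border 1 (-x) 1 =
        (border 1 x 1 * border 1 (-x) 1)ᵀ * border (S 0 0) 0 (schur S) *
          (border 1 x 1 * border 1 (-x) 1) := by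
      conv_lhs => rw [h]
      simp only [Matrix.transpose_mul, Matrix.mul_assoc]
    rw [h2, hinv]; simp
  have h3 : (border (S 0 0) 0 (schur S)).PosDef := by
    rw [← h1]
    exact posDef_congruence hS (by rw [det_border]; simp)
  have h4 := h3.submatrix (Fin.succ_injective n)
  have h5 : (border (S 0 0) 0 (schur S)).submatrix Fin.succ Fin.succ = schur S := by
    ext i j; simp
  rwa [h5] at h4

/-- Upper triangular matrices with ones on the diagonal. -/
def IsUnipotentUpper {n : ℕ} (u : Matrix (Fin n) (Fin n) ℝ) : Prop :=
  (∀ i, u i i = 1) ∧ ∀ i j, j < i → u i j = 0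

theorem IsUnipotentUpper.border {n : ℕ} {u : Matrix (Fin n) (Fin n) ℝ} (hu : IsUnipotentUpper u)
    (x : Fin n → ℝ) : IsUnipotentUpper (border 1 x u) := by
  refine ⟨fun i => ?_, fun i j => ?_⟩
  · refine Fin.cases ?_ (fun i => ?_) i
    · simp
    · simpa using hu.1 i
  · refine Fin.cases ?_ (fun i => ?_) i <;> refine Fin.cases ?_ (fun j => ?_) j
    · simp
    · simp
    · simp
    · simpa using hu.2 i j

theorem IsUnipotentUpper.det {n : ℕ} {u : Matrix (Fin n) (Fin n) ℝ} (hu : IsUnipotentUpper u) :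
    u.det = 1 := by
  rw [Matrix.det_of_isUpperTriangular (fun i j hij => hu.2 i j hij)]
  simp [hu.1]

/-- The `LDLᵀ` decomposition of a positive definite matrix, written with `u = Lᵀ`. -/
theorem exists_unipotent_congruence (n : ℕ) (S : Matrix (Fin n) (Fin n) ℝ) (hS : S.PosDef) :
    ∃ (u : Matrix (Fin n) (Fin n) ℝ) (d : Fin n → ℝ), IsUnipotentUpper u ∧ (∀ i, 0 < d i) ∧
      S = uᵀ * Matrix.diagonal d * u := by
  induction n with
  | zero => exact ⟨1, 1, ⟨by simp, by simp⟩, by simp, Subsingleton.elim _ _⟩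
  | succ n ih =>
    obtain ⟨u, d, hu, hd, h⟩ := ih (schur S) (posDef_schur hS)
    refine ⟨border 1 (fun j => S 0 j.succ / S 0 0) u, Fin.cons (S 0 0) d, hu.border _,
      fun i => Fin.cases hS.diag_pos (fun i => hd i) i, ?_⟩
    rw [← border_diagonal]
    conv_lhs => rw [eq_border_schur hS]
    exact border_congruence _ _ (by simpa using h)

/-- A positive definite form takes only finitely many values below any bound on `ℤⁿ`. -/
theorem tendsto_quadForm_cofinite {n : ℕ} {S : Matrix (Fin n) (Fin n) ℝ} (hS : S.PosDef) :
    Filter.Tendsto (fun w : Fin n → ℤ => (fun i => (w i : ℝ)) ⬝ᵥ S *ᵥ fun i => (w i : ℝ))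
      Filter.cofinite Filter.atTop := by
  obtain ⟨u, d, hu, hd, h⟩ := exists_unipotent_congruence n S hS
  set B : Matrix (Fin n) (Fin n) ℝ := Matrix.diagonal (fun i => √(d i)) * u
  have hB : S = Bᵀ * B := by
    have hdd : Matrix.diagonal d = Matrix.diagonal (fun i => √(d i)) *
        Matrix.diagonal (fun i => √(d i)) := by
      rw [Matrix.diagonal_mul_diagonal]
      congr 1; ext i; exact (Real.mul_self_sqrt (hd i).le).symm
    rw [h, hdd]
    simp only [B, Matrix.transpose_mul, Matrix.diagonal_transpose, Matrix.mul_assoc]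
  have hBu : IsUnit B := by
    rw [Matrix.isUnit_iff_isUnit_det, Matrix.det_mul, hu.det, Matrix.det_diagonal, mul_one,
      isUnit_iff_ne_zero]
    exact Finset.prod_ne_zero_iff.2 fun i _ => (Real.sqrt_pos.2 (hd i)).ne'
  have hclosed : Topology.IsClosedEmbedding (fun v : Fin n → ℝ => B *ᵥ v) := by
    have := LinearMap.isClosedEmbedding_of_injective (f := B.mulVecLin)
      (LinearMap.ker_eq_bot.2 (Matrix.mulVec_injective_of_isUnit hBu))
    exact this
  have hint : Topology.IsClosedEmbedding (fun w : Fin n → ℤ => fun i => (w i : ℝ)) :=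
    Topology.IsClosedEmbedding.piMap fun _ => Int.isClosedEmbedding_coe_real
  have h1 := (hclosed.comp hint).tendsto_cocompact
  rw [Filter.cocompact_eq_cofinite] at h1
  have h2 := (tendsto_norm_cocompact_atTop (E := Fin n → ℝ)).comp h1
  have h3 := (Filter.tendsto_pow_atTop (α := ℝ) two_ne_zero).comp h2
  refine Filter.tendsto_atTop_mono (fun w => ?_) h3
  set v : Fin n → ℝ := fun i => (w i : ℝ)
  have h4 : v ⬝ᵥ S *ᵥ v = (B *ᵥ v) ⬝ᵥ (B *ᵥ v) := by
    rw [hB, ← Matrix.mulVec_mulVec, Matrix.dotProduct_mulVec, Matrix.vecMul_transpose]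
  show ‖B *ᵥ v‖ ^ 2 ≤ v ⬝ᵥ S *ᵥ v
  rw [h4]
  set y := B *ᵥ v
  have hnn : 0 ≤ y ⬝ᵥ y := Finset.sum_nonneg fun i _ => mul_self_nonneg _
  have : ‖y‖ ≤ √(y ⬝ᵥ y) := by
    rw [pi_norm_le_iff_of_nonneg (Real.sqrt_nonneg _)]
    intro i
    rw [Real.norm_eq_abs]
    refine Real.abs_le_sqrt ?_
    rw [sq]
    exact Finset.single_le_sum (f := fun i => y i * y i) (fun i _ => mul_self_nonneg _)
      (Finset.mem_univ i)
  calc ‖y‖ ^ 2 ≤ √(y ⬝ᵥ y) ^ 2 := by gcongr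
    _ = y ⬝ᵥ y := Real.sq_sqrt hnn

/-- The real matrix underlying an element of `SL_n(ℤ)`. -/
def intMat {n : ℕ} (γ : Matrix.SpecialLinearGroup (Fin n) ℤ) : Matrix (Fin n) (Fin n) ℝ :=
  (γ : Matrix (Fin n) (Fin n) ℤ).map (Int.castRingHom ℝ)

theorem intMat_mul {n : ℕ} (γ δ : Matrix.SpecialLinearGroup (Fin n) ℤ) :
    intMat (γ * δ) = intMat γ * intMat δ := by
  rw [intMat, Matrix.SpecialLinearGroup.coe_mul, Matrix.map_mul]
  rfl

theorem det_intMat {n : ℕ} (γ : Matrix.SpecialLinearGroup (Fin n) ℤ) : (intMat γ).det = 1 := by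
  have := (RingHom.map_det (Int.castRingHom ℝ) (γ : Matrix (Fin n) (Fin n) ℤ)).symm
  simpa [intMat] using this

theorem congruence_diag_apply {n : ℕ} (S A : Matrix (Fin n) (Fin n) ℝ) (i : Fin n) :
    (Aᵀ * S * A) i i = (fun k => A k i) ⬝ᵥ S *ᵥ fun k => A k i := by
  rw [Matrix.mul_assoc, Matrix.mul_apply_eq_vecMul, Matrix.dotProduct_mulVec]
  simp only [Matrix.vecMul, dotProduct, Matrix.mul_apply, Matrix.transpose_apply,
    Finset.mul_sum, Finset.sum_mul]
  rw [Finset.sum_comm]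
  simp only [mul_assoc]

/-- In the `SL_n(ℤ)`-orbit of a positive definite form some member has the smallest upper left
entry. Since `SL_n(ℤ)` acts transitively on the standard basis vectors up to sign, that entry is at
most every diagonal entry of every member. -/
theorem exists_minimal_corner {n : ℕ} {S : Matrix (Fin (n + 1)) (Fin (n + 1)) ℝ} (hS : S.PosDef) :
    ∃ γ : Matrix.SpecialLinearGroup (Fin (n + 1)) ℤ,
      ∀ (δ : Matrix.SpecialLinearGroup (Fin (n + 1)) ℤ) (i : Fin (n + 1)),
        ((intMat γ)ᵀ * S * intMat γ) 0 0 ≤ ((intMat δ)ᵀ * S * intMat δ) i i := by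
  obtain ⟨w, ⟨γ, rfl⟩, hw⟩ := (tendsto_quadForm_cofinite hS).exists_within_forall_le
    (Set.range_nonempty
      (fun γ : Matrix.SpecialLinearGroup (Fin (n + 1)) ℤ => fun i => γ i 0))
  refine ⟨γ, fun δ i => ?_⟩
  -- `δ * τ` has `δ e_i` as its first column
  obtain ⟨τ, hτ⟩ : ∃ τ : Matrix.SpecialLinearGroup (Fin (n + 1)) ℤ,
      ∀ k, τ k 0 = (1 : Matrix (Fin (n + 1)) (Fin (n + 1)) ℤ) k i := by
    by_cases hi : i = 0
    · exact ⟨1, fun k => by rw [hi]; rfl⟩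
    · refine ⟨⟨Matrix.transvection 0 i (-1) * Matrix.transvection i 0 1, ?_⟩, fun k => ?_⟩
      · rw [Matrix.det_mul, Matrix.det_transvection_of_ne _ _ (Ne.symm hi),
          Matrix.det_transvection_of_ne _ _ hi, one_mul]
      · show (Matrix.transvection 0 i (-1) * Matrix.transvection i 0 1 :
          Matrix (Fin (n + 1)) (Fin (n + 1)) ℤ) k 0 = _
        have hi' : (0 : Fin (n + 1)) ≠ i := Ne.symm hi
        simp only [Matrix.transvection, Matrix.add_mul, Matrix.mul_add, Matrix.one_mul,
          Matrix.mul_one, Matrix.add_apply, Matrix.single_mul_single_same, Matrix.single_apply,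
          Matrix.one_apply]
        by_cases hk : k = 0 <;> by_cases hk' : k = i <;> simp_all
        all_goals grind
  have h1 : ∀ k, (δ * τ) k 0 = δ k i := by
    intro k
    rw [Matrix.SpecialLinearGroup.coe_mul, Matrix.mul_apply]
    simp [hτ, Matrix.one_apply]
  have h2 := hw _ ⟨δ * τ, rfl⟩
  rw [congruence_diag_apply, congruence_diag_apply]
  simp only [h1] at h2
  exact h2

/-- Reduction of positive definite forms: every form is `SL_n(ℤ)`-equivalent to `uᵀ diag(d) u` with
`|u_{ij}| ≤ 1/2` and `d_i ≤ (4/3) d_{i+1}`. The upper left entry is made minimal; then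
`d_0 ≤ d_0 u_{01}² + d_1 ≤ d_0 / 4 + d_1`, and the Schur complement is reduced recursively. -/
theorem exists_reduced_congruence (n : ℕ) (S : Matrix (Fin n) (Fin n) ℝ) (hS : S.PosDef) :
    ∃ (γ : Matrix.SpecialLinearGroup (Fin n) ℤ) (u : Matrix (Fin n) (Fin n) ℝ) (d : Fin n → ℝ),
      IsUnipotentUpper u ∧ (∀ i j, i < j → |u i j| ≤ 1 / 2) ∧ (∀ i, 0 < d i) ∧
      (∀ i j : Fin n, (j : ℕ) = (i : ℕ) + 1 → d i ≤ 4 / 3 * d j) ∧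
      (intMat γ)ᵀ * S * intMat γ = uᵀ * Matrix.diagonal d * u := by
  induction n with
  | zero =>
    exact ⟨1, 1, 1, ⟨by simp, by simp⟩, by simp, by simp, by simp, Subsingleton.elim _ _⟩
  | succ n ih =>
    obtain ⟨γ₀, hγ₀⟩ := exists_minimal_corner hS
    set S₀ := (intMat γ₀)ᵀ * S * intMat γ₀ with hS₀
    have hS₀pos : S₀.PosDef := posDef_congruence hS (by rw [det_intMat]; exact isUnit_one)
    obtain ⟨γ', u, d, hu, hu2, hd, hd2, h⟩ := ih (schur S₀) (posDef_schur hS₀pos)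
    set x : Fin n → ℝ := fun j => S₀ 0 j.succ / S₀ 0 0 with hx
    set y : Fin n → ℝ := x ᵥ* intMat γ' with hy
    set z : Fin n → ℤ := fun j => -round (y j) with hz
    let γ₁ : Matrix.SpecialLinearGroup (Fin (n + 1)) ℤ :=
      ⟨border 1 z γ', by rw [det_border]; simp⟩
    set v : Fin n → ℝ := fun j => y j - round (y j) with hv
    have hγ₁ : border 1 x 1 * intMat γ₁ = border 1 v (intMat γ') := by
      have : intMat γ₁ = border 1 (fun j => (z j : ℝ)) (intMat γ') := by
        simp only [intMat, γ₁]
        rw [border_map]; simp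
      rw [this, border_mul, mul_one, Matrix.one_mul]
      congr 1
      ext j
      simp [hv, hz, hy]
      ring
    have key : (intMat (γ₀ * γ₁))ᵀ * S * intMat (γ₀ * γ₁) =
        (border 1 v u)ᵀ * Matrix.diagonal (Fin.cons (S₀ 0 0) d : Fin (n + 1) → ℝ) *
          border 1 v u := by
      rw [← border_diagonal, ← border_congruence _ _ h, ← hγ₁]
      calc (intMat (γ₀ * γ₁))ᵀ * S * intMat (γ₀ * γ₁)
          = (intMat γ₁)ᵀ * S₀ * intMat γ₁ := by
            rw [intMat_mul, hS₀]; simp only [Matrix.transpose_mul, Matrix.mul_assoc]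
        _ = _ := by
            conv_lhs => rw [eq_border_schur hS₀pos]
            simp only [Matrix.transpose_mul, Matrix.mul_assoc, hx]
    have hvle : ∀ j, |v j| ≤ 1 / 2 := fun j => abs_sub_round (y j)
    refine ⟨γ₀ * γ₁, border 1 v u, Fin.cons (S₀ 0 0) d, hu.border v, ?_, ?_, ?_, key⟩
    · intro i j
      refine Fin.cases ?_ (fun i => ?_) i <;> refine Fin.cases ?_ (fun j => ?_) j
      · simp
      · intro _; simpa using hvle j
      · simp
      · intro hij; simpa using hu2 i j (by simpa using hij)
    · exact fun i => Fin.cases hS₀pos.diag_pos (fun i => hd i) i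
    · intro i j
      refine Fin.cases ?_ (fun i => ?_) i <;> refine Fin.cases ?_ (fun j => ?_) j
      · simp
      · intro hj
        have hj0 : (j : ℕ) = 0 := by simpa using hj
        have hmin := hγ₀ (γ₀ * γ₁) j.succ
        rw [key] at hmin
        have hcol : ∀ k : Fin n, u k j = if k = j then 1 else 0 := by
          intro k
          split_ifs with hk
          · rw [hk, hu.1]
          · exact hu.2 _ _ (by
              rw [Fin.lt_def]
              have : (k : ℕ) ≠ j := fun h => hk (Fin.ext h)
              omega)
        have hval : ((border 1 v u)ᵀ * Matrix.diagonal (Fin.cons (S₀ 0 0) d : Fin (n + 1) → ℝ) *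
            border 1 v u) j.succ j.succ = S₀ 0 0 * v j ^ 2 + d j := by
          rw [Matrix.mul_apply, Fin.sum_univ_succ]
          simp [Matrix.mul_diagonal, hcol]
          ring
        rw [hval] at hmin
        have h14 : v j ^ 2 ≤ 1 / 4 := by
          have := abs_le.1 (hvle j)
          nlinarith
        have hp : 0 < S₀ 0 0 := hS₀pos.diag_pos
        simp only [Fin.cons_zero, Fin.cons_succ]
        nlinarith
      · simp
      · intro hij; simpa using hd2 i j (by simpa using hij)

/-- Upper triangular unipotent matrices as elements of `SL_n(ℝ)`. -/
def unipotentSL {n : ℕ} (u : Matrix (Fin n) (Fin n) ℝ) (hu : IsUnipotentUpper u) : G n :=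
  ⟨u, hu.det⟩

theorem mem_K_iff {n : ℕ} {g : G n} :
    g ∈ K n ↔ (g : Matrix (Fin n) (Fin n) ℝ)ᵀ * (g : Matrix (Fin n) (Fin n) ℝ) = 1 :=
  Matrix.mem_orthogonalGroup_iff' (Fin n) ℝ

/-- If `gᵀ g = uᵀ diag(d) u`, then `g = k a u` with `k` orthogonal and `a = diag(√d)`. -/
theorem exists_orthogonal_of_gram {n : ℕ} (g : G n) {u : Matrix (Fin n) (Fin n) ℝ}
    (hu : IsUnipotentUpper u) {d : Fin n → ℝ} (hd : ∀ i, 0 < d i)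
    (h : (g : Matrix (Fin n) (Fin n) ℝ)ᵀ * g = uᵀ * Matrix.diagonal d * u) :
    ∃ k ∈ K n, ∃ a : G n, (a : Matrix (Fin n) (Fin n) ℝ) = Matrix.diagonal (fun i => √(d i)) ∧
      g = k * a * unipotentSL u hu := by
  have hdprod : ∏ i, d i = 1 := by
    have := congrArg Matrix.det h
    simpa [hu.det] using this.symm
  let a : G n := ⟨Matrix.diagonal (fun i => √(d i)), by
    rw [Matrix.det_diagonal, ← Real.sqrt_prod _ (fun i _ => (hd i).le), hdprod, Real.sqrt_one]⟩
  have haa : (a : Matrix (Fin n) (Fin n) ℝ)ᵀ * a = Matrix.diagonal d := by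
    simp only [a, Matrix.diagonal_transpose, Matrix.diagonal_mul_diagonal]
    congr 1; ext i; exact Real.mul_self_sqrt (hd i).le
  set b : G n := a * unipotentSL u hu with hb
  have hbb : (b : Matrix (Fin n) (Fin n) ℝ)ᵀ * b = (g : Matrix (Fin n) (Fin n) ℝ)ᵀ * g := by
    have hU : (unipotentSL u hu : Matrix (Fin n) (Fin n) ℝ) = u := rfl
    rw [h, ← haa, hb, Matrix.SpecialLinearGroup.coe_mul, hU]
    simp only [Matrix.transpose_mul, Matrix.mul_assoc]
  refine ⟨g * b⁻¹, ?_, a, rfl, by rw [mul_assoc, ← hb, inv_mul_cancel_right]⟩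
  rw [mem_K_iff]
  have hinv : (b : Matrix (Fin n) (Fin n) ℝ) * ((b⁻¹ : G n) : Matrix (Fin n) (Fin n) ℝ) = 1 := by
    rw [← Matrix.SpecialLinearGroup.coe_mul, mul_inv_cancel, Matrix.SpecialLinearGroup.coe_one]
  rw [Matrix.SpecialLinearGroup.coe_mul, Matrix.transpose_mul, Matrix.mul_assoc,
    ← Matrix.mul_assoc _ (g : Matrix (Fin n) (Fin n) ℝ), ← hbb, Matrix.mul_assoc, hinv,
    Matrix.mul_one, ← Matrix.transpose_mul, hinv, Matrix.transpose_one]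

theorem posDef_gram {n : ℕ} (g : G n) : ((g : Matrix (Fin n) (Fin n) ℝ)ᵀ * g).PosDef := by
  have := Matrix.PosDef.conjTranspose_mul_self (g : Matrix (Fin n) (Fin n) ℝ)
    (Matrix.mulVec_injective_of_isUnit ((Matrix.isUnit_iff_isUnit_det _).2 (by simp)))
  rwa [Matrix.conjTranspose_eq_transpose_of_trivial] at this

/-- Every `SL_n(ℤ)`-orbit under right translations meets the Siegel set. -/
theorem exists_mul_mem_siegel {n : ℕ} (g : G n) :
    ∃ γ ∈ Gam n, g * γ ∈ siegel n (2 / √3) (1 / 2) := by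
  obtain ⟨γ, u, d, hu, hu2, hd, hd2, h⟩ := exists_reduced_congruence n _ (posDef_gram g)
  set γR : G n := Matrix.SpecialLinearGroup.map (Int.castRingHom ℝ) γ with hγR
  have hcoe : (γR : Matrix (Fin n) (Fin n) ℝ) = intMat γ := by
    ext i j; simp [hγR, intMat]
  have h' : ((g * γR : G n) : Matrix (Fin n) (Fin n) ℝ)ᵀ * (g * γR : G n) =
      uᵀ * Matrix.diagonal d * u := by
    rw [← h, Matrix.SpecialLinearGroup.coe_mul, hcoe]
    simp only [Matrix.transpose_mul, Matrix.mul_assoc]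
  obtain ⟨k, hk, a, ha, heq⟩ := exists_orthogonal_of_gram _ hu hd h'
  refine ⟨γR, ⟨γ, rfl⟩, ?_⟩
  rw [heq]
  refine Set.mul_mem_mul (Set.mul_mem_mul hk ⟨_, fun i => Real.sqrt_pos.2 (hd i), ha, ?_⟩)
    ⟨hu.1, hu.2, hu2⟩
  intro i j hij
  rw [div_le_div_iff₀ (Real.sqrt_pos.2 (hd j)) (by positivity), ← Real.sqrt_mul (hd i).le,
    show (2 : ℝ) = √4 by rw [show (4 : ℝ) = 2 ^ 2 by norm_num, Real.sqrt_sq (by norm_num)],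
    ← Real.sqrt_mul (by norm_num)]
  exact Real.sqrt_le_sqrt (by linarith [hd2 i j hij])

/-! ### The cone measure on `SL_n(ℝ)` -/

section cone

/-- The entries of an element of `SL_n(ℝ)`, as a point of the measurable space
`Fin n → Fin n → ℝ`. -/
def entries (n : ℕ) (g : G n) : Fin n → Fin n → ℝ := fun i j => g i j

theorem isClosedEmbedding_entries (n : ℕ) : Topology.IsClosedEmbedding (entries n) :=
  Matrix.SpecialLinearGroup.isClosedEmbedding_val

theorem measurableEmbedding_entries (n : ℕ) : MeasurableEmbedding (entries n) :=
  (isClosedEmbedding_entries n).measurableEmbedding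

instance instPolishSpaceG (n : ℕ) : PolishSpace (G n) :=
  (isClosedEmbedding_entries n).polishSpace

instance instLocallyCompactSpaceG (n : ℕ) : LocallyCompactSpace (G n) :=
  (isClosedEmbedding_entries n).locallyCompactSpace

theorem measurePreserving_transpose (n : ℕ) :
    MeasurePreserving (fun (M : Fin n → Fin n → ℝ) i j => M j i) volume volume := by
  let f : (Fin n → Fin n → ℝ) →ₗ[ℝ] (Fin n → Fin n → ℝ) :=
    { toFun := fun M i j => M j i
      map_add' := fun _ _ => rfl
      map_smul' := fun _ _ => rfl }
  have hff : f * f = 1 := rfl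
  have hdet : LinearMap.det f * LinearMap.det f = 1 := by
    rw [← map_mul, hff, map_one]
  have hne : LinearMap.det f ≠ 0 := fun h => by simp [h] at hdet
  have habs : |LinearMap.det f| = 1 := by
    have : |LinearMap.det f| * |LinearMap.det f| = 1 := by rw [← abs_mul, hdet, abs_one]
    nlinarith [abs_nonneg (LinearMap.det f)]
  refine ⟨f.continuous_of_finiteDimensional.measurable, ?_⟩
  have := Measure.map_linearMap_addHaar_eq_smul_addHaar volume hne
  rw [abs_inv, habs, inv_one, ENNReal.ofReal_one, one_smul] at this
  exact this

theorem measurePreserving_mul_right_entries {n : ℕ} (g : G n) :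
    MeasurePreserving
      (fun (M : Fin n → Fin n → ℝ) => (Matrix.of M * (g : Matrix _ _ ℝ) : Fin n → Fin n → ℝ))
      volume volume := by
  refine volume_preserving_pi (f := fun _ x => x ᵥ* (g : Matrix (Fin n) (Fin n) ℝ)) fun i => ?_
  have h := Real.map_matrix_volume_pi_eq_smul_volume_pi
    (M := (g : Matrix (Fin n) (Fin n) ℝ)ᵀ) (by simp)
  rw [Matrix.det_transpose, g.det_coe] at h
  refine ⟨by fun_prop, ?_⟩
  have h2 : (fun x : Fin n → ℝ => x ᵥ* (g : Matrix _ _ ℝ)) =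
      (toLin' (g : Matrix (Fin n) (Fin n) ℝ)ᵀ) := by
    ext1 x; rw [Matrix.toLin'_apply, Matrix.mulVec_transpose]
  rw [h2, h]; simp

theorem measurePreserving_mul_left_entries {n : ℕ} (g : G n) :
    MeasurePreserving
      (fun (M : Fin n → Fin n → ℝ) => ((g : Matrix _ _ ℝ) * Matrix.of M : Fin n → Fin n → ℝ))
      volume volume := by
  have h := (measurePreserving_transpose n).comp
    ((measurePreserving_mul_right_entries g.transpose).comp (measurePreserving_transpose n))
  convert h using 1
  ext M i j
  show ((g : Matrix (Fin n) (Fin n) ℝ) * Matrix.of M : Matrix (Fin n) (Fin n) ℝ) i j =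
    ((Matrix.of fun i j => M j i) * (g : Matrix (Fin n) (Fin n) ℝ)ᵀ : Matrix (Fin n) (Fin n) ℝ) j i
  simp [Matrix.mul_apply, mul_comm]

/-- The rescaling `det(M)^{-1/n} M` of a matrix of positive determinant. -/
noncomputable def rescale (n : ℕ) [NeZero n] (M : Fin n → Fin n → ℝ)
    (h : 0 < (Matrix.of M).det) : G n :=
  ⟨((Matrix.of M).det ^ (-(n : ℝ)⁻¹)) • Matrix.of M, by
    rw [Matrix.det_smul, Fintype.card_fin, ← Real.rpow_natCast, ← Real.rpow_mul h.le,
      neg_mul, inv_mul_cancel₀ (Nat.cast_ne_zero.2 (NeZero.ne n)), Real.rpow_neg_one,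
      inv_mul_cancel₀ h.ne']⟩

open scoped Classical in
/-- The radial projection `M ↦ det(M)^{-1/n} M` from matrices of positive determinant to
`SL_n(ℝ)`; it takes the junk value `1` elsewhere. -/
noncomputable def radial (n : ℕ) [NeZero n] (M : Fin n → Fin n → ℝ) : G n :=
  if h : 0 < (Matrix.of M).det then rescale n M h else 1

variable {n : ℕ} [NeZero n]

theorem coe_radial {M : Fin n → Fin n → ℝ} (h : 0 < (Matrix.of M).det) :
    (radial n M : Matrix (Fin n) (Fin n) ℝ) =
      ((Matrix.of M).det ^ (-(n : ℝ)⁻¹)) • Matrix.of M := by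
  rw [radial, dif_pos h]; rfl

theorem entries_radial {M : Fin n → Fin n → ℝ} (h : 0 < (Matrix.of M).det) :
    entries n (radial n M) = ((Matrix.of M).det ^ (-(n : ℝ)⁻¹)) • M :=
  coe_radial h

theorem continuous_det_of (n : ℕ) :
    Continuous fun M : Fin n → Fin n → ℝ => (Matrix.of M).det :=
  Continuous.matrix_det continuous_id

theorem continuousOn_radial :
    ContinuousOn (radial n) {M | 0 < (Matrix.of M).det} := by
  rw [(isClosedEmbedding_entries n).isEmbedding.continuousOn_iff]
  have : ContinuousOn (fun M : Fin n → Fin n → ℝ => ((Matrix.of M).det ^ (-(n : ℝ)⁻¹)) • M)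
      {M | 0 < (Matrix.of M).det} :=
    ((continuous_det_of n).continuousOn.rpow_const fun M hM => Or.inl (ne_of_gt hM)).smul
      continuousOn_id
  exact this.congr fun M hM => entries_radial hM

theorem measurable_radial : Measurable (radial n) := by
  classical
  rw [← (measurableEmbedding_entries n).measurable_comp_iff]
  have hS : MeasurableSet {M : Fin n → Fin n → ℝ | 0 < (Matrix.of M).det} :=
    (isOpen_lt continuous_const (continuous_det_of n)).measurableSet
  have : entries n ∘ radial n = fun M =>
      if M ∈ {M : Fin n → Fin n → ℝ | 0 < (Matrix.of M).det}
      then ((Matrix.of M).det ^ (-(n : ℝ)⁻¹)) • M else entries n 1 := by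
    ext1 M
    split_ifs with h
    · exact entries_radial h
    · have h' : ¬ 0 < (Matrix.of M).det := h
      simp only [Function.comp, radial, dif_neg h']
  rw [this]
  refine Measurable.ite hS ?_ measurable_const
  exact ((continuous_det_of n).measurable.pow_const _).smul measurable_id

theorem radial_mul_left (g : G n) {M : Fin n → Fin n → ℝ} (h : 0 < (Matrix.of M).det) :
    radial n ((g : Matrix _ _ ℝ) * Matrix.of M) = g * radial n M := by
  have hdet : (Matrix.of ((g : Matrix _ _ ℝ) * Matrix.of M : Fin n → Fin n → ℝ)).det =
      (Matrix.of M).det := by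
    have := Matrix.det_mul (g : Matrix _ _ ℝ) (Matrix.of M)
    rwa [g.det_coe, one_mul] at this
  apply Subtype.ext
  rw [coe_radial (by rwa [hdet]), hdet, Matrix.SpecialLinearGroup.coe_mul, coe_radial h,
    Matrix.mul_smul]
  rfl

theorem radial_mul_right (g : G n) {M : Fin n → Fin n → ℝ} (h : 0 < (Matrix.of M).det) :
    radial n (Matrix.of M * (g : Matrix _ _ ℝ)) = radial n M * g := by
  have hdet : (Matrix.of (Matrix.of M * (g : Matrix _ _ ℝ) : Fin n → Fin n → ℝ)).det =
      (Matrix.of M).det := by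
    have := Matrix.det_mul (Matrix.of M) (g : Matrix _ _ ℝ)
    rwa [g.det_coe, mul_one] at this
  apply Subtype.ext
  rw [coe_radial (by rwa [hdet]), hdet, Matrix.SpecialLinearGroup.coe_mul, coe_radial h,
    Matrix.smul_mul]
  rfl

/-- The matrices with determinant in `(0, 1]`. -/
def detUnit (n : ℕ) : Set (Fin n → Fin n → ℝ) :=
  {M | 0 < (Matrix.of M).det ∧ (Matrix.of M).det ≤ 1}

theorem measurableSet_detUnit (n : ℕ) : MeasurableSet (detUnit n) :=
  (isOpen_lt continuous_const (continuous_det_of n)).measurableSet.inter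
    (isClosed_le (continuous_det_of n) continuous_const).measurableSet

/-- The cone measure on `SL_n(ℝ)`: the measure of `E` is the Lebesgue measure of
`{s g | g ∈ E, 0 < s ≤ 1}`. -/
noncomputable def coneMeasure (n : ℕ) [NeZero n] : Measure (G n) :=
  (volume.restrict (detUnit n)).map (radial n)

theorem map_coneMeasure {F : (Fin n → Fin n → ℝ) → (Fin n → Fin n → ℝ)} {f : G n → G n}
    (hF : MeasurePreserving F volume volume) (hf : Measurable f)
    (hdet : ∀ M, (Matrix.of (F M)).det = (Matrix.of M).det)
    (h : ∀ M, 0 < (Matrix.of M).det → radial n (F M) = f (radial n M)) :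
    (coneMeasure n).map f = coneMeasure n := by
  have hpre : F ⁻¹' detUnit n = detUnit n := by
    ext M; simp only [detUnit, Set.mem_preimage, Set.mem_ofPred_eq, hdet]
  have hr := hF.restrict_preimage (measurableSet_detUnit n)
  rw [hpre] at hr
  rw [coneMeasure, Measure.map_map hf measurable_radial]
  conv_rhs => rw [← hr.map_eq, Measure.map_map measurable_radial hF.measurable]
  refine Measure.map_congr ?_
  filter_upwards [ae_restrict_mem (measurableSet_detUnit n)] with M hM
  exact (h M hM.1).symm

instance : (coneMeasure n).IsMulLeftInvariant where
  map_mul_left_eq_self g := map_coneMeasure (measurePreserving_mul_left_entries g)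
    (measurable_const_mul g) (fun M => by
      have := Matrix.det_mul (g : Matrix _ _ ℝ) (Matrix.of M)
      rwa [g.det_coe, one_mul] at this) fun M hM => radial_mul_left g hM

instance : (coneMeasure n).IsMulRightInvariant where
  map_mul_right_eq_self g := map_coneMeasure (measurePreserving_mul_right_entries g)
    (measurable_mul_const g) (fun M => by
      have := Matrix.det_mul (Matrix.of M) (g : Matrix _ _ ℝ)
      rwa [g.det_coe, mul_one] at this) fun M hM => radial_mul_right g hM

instance : IsFiniteMeasureOnCompacts (coneMeasure n) where
  lt_top_of_isCompact := by
    intro C hC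
    obtain ⟨R, hR⟩ := (hC.image (isClosedEmbedding_entries n).continuous).isBounded.exists_norm_le
    rw [coneMeasure, Measure.map_apply measurable_radial hC.measurableSet,
      Measure.restrict_apply (measurable_radial hC.measurableSet)]
    refine lt_of_le_of_lt (measure_mono ?_)
      (isCompact_closedBall (0 : Fin n → Fin n → ℝ) R).measure_lt_top
    rintro M ⟨hM, h0, h1⟩
    have h2 : ‖entries n (radial n M)‖ ≤ R := hR _ ⟨_, hM, rfl⟩
    rw [entries_radial h0, norm_smul, Real.norm_of_nonneg (Real.rpow_nonneg h0.le _)] at h2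
    have h3 : 1 ≤ (Matrix.of M).det ^ (-(n : ℝ)⁻¹) :=
      Real.one_le_rpow_of_pos_of_le_one_of_nonpos h0 h1 (by simp)
    rw [mem_closedBall_zero_iff]
    nlinarith [norm_nonneg M]

instance : (coneMeasure n).IsOpenPosMeasure where
  open_pos := by
    rintro U hU ⟨g, hg⟩
    rw [coneMeasure, Measure.map_apply measurable_radial hU.measurableSet,
      Measure.restrict_apply (measurable_radial hU.measurableSet)]
    have ho : IsOpen ({M : Fin n → Fin n → ℝ | 0 < (Matrix.of M).det} ∩ radial n ⁻¹' U) :=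
      continuousOn_radial.isOpen_inter_preimage
        (isOpen_lt continuous_const (continuous_det_of n)) hU
    have ho2 := ho.inter (isOpen_lt (continuous_det_of n) (continuous_const (y := (1 : ℝ))))
    set M : Fin n → Fin n → ℝ := (1 / 2 : ℝ) • entries n g with hM
    have hMdet : (Matrix.of M).det = (1 / 2 : ℝ) ^ n := by
      have : Matrix.of M = (1 / 2 : ℝ) • (g : Matrix (Fin n) (Fin n) ℝ) := rfl
      rw [this, Matrix.det_smul, g.det_coe, Fintype.card_fin, mul_one]
    have hpos : 0 < (Matrix.of M).det := by rw [hMdet]; positivity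
    have hrad : radial n M = g := by
      apply (isClosedEmbedding_entries n).injective
      rw [entries_radial hpos, hMdet, ← Real.rpow_natCast, ← Real.rpow_mul (by norm_num),
        mul_neg, mul_inv_cancel₀ (Nat.cast_ne_zero.2 (NeZero.ne n)), Real.rpow_neg_one, hM,
        smul_smul]
      norm_num
    have hmem : M ∈ ({M : Fin n → Fin n → ℝ | 0 < (Matrix.of M).det} ∩ radial n ⁻¹' U) ∩
        {M | (Matrix.of M).det < 1} := by
      refine ⟨⟨hpos, ?_⟩, ?_⟩
      · rw [Set.mem_preimage, hrad]; exact hg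
      · show (Matrix.of M).det < 1
        rw [hMdet]
        exact pow_lt_one₀ (by norm_num) (by norm_num) (NeZero.ne n)
    have hpos2 := (ho2.measure_pos volume ⟨M, hmem⟩)
    refine (lt_of_lt_of_le hpos2 (measure_mono ?_)).ne'
    rintro M' ⟨⟨h1, h2⟩, h3⟩
    exact ⟨h2, h1, le_of_lt h3⟩

instance : (coneMeasure n).IsHaarMeasure where

/-- A bi-invariant Haar measure is invariant under inversion: `μ⁻¹ = c μ` by uniqueness, and
`c = 1` because there are symmetric sets of positive finite measure. -/
theorem isInvInvariant_of_biinvariant {H : Type*} [Group H] [TopologicalSpace H]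
    [IsTopologicalGroup H] [LocallyCompactSpace H] [SecondCountableTopology H] [MeasurableSpace H]
    [BorelSpace H] (μ : Measure H) [μ.IsHaarMeasure] [μ.IsMulRightInvariant] :
    μ.IsInvInvariant := by
  obtain ⟨C, hC, hC1⟩ := exists_compact_mem_nhds (1 : H)
  set V : Set H := C ∪ C⁻¹ with hV
  have hVc : IsCompact V := hC.union hC.inv
  have hVinv : V⁻¹ = V := by rw [hV, Set.union_inv, inv_inv, Set.union_comm]
  have hV0 : μ V ≠ 0 :=
    (Measure.measure_pos_of_mem_nhds μ (Filter.mem_of_superset hC1 Set.subset_union_left)).ne'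
  have h := measure_eq_div_smul μ.inv μ hV0 hVc.measure_lt_top.ne
  rw [Measure.inv_apply, hVinv, ENNReal.div_self hV0 hVc.measure_lt_top.ne, one_smul] at h
  exact ⟨h⟩

end cone

/-! ### The Iwasawa decomposition -/

theorem diagEntry_pos (n : ℕ) (t : Fin (n - 1) → ℝ) (i : Fin n) : 0 < diagEntry n t i := by
  rw [diagEntry]; split_ifs <;> positivity

theorem diagEntry_add (n : ℕ) (t t' : Fin (n - 1) → ℝ) (i : Fin n) :
    diagEntry n (t + t') i = diagEntry n t i * diagEntry n t' i := by
  rw [diagEntry, diagEntry, diagEntry]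
  split_ifs
  · rw [← Real.exp_add]; rfl
  · rw [← Real.exp_add]; congr 1; simp [Finset.sum_add_distrib]; ring

theorem continuous_diagEntry (n : ℕ) (i : Fin n) : Continuous fun t => diagEntry n t i := by
  unfold diagEntry
  split_ifs <;> fun_prop

theorem diagEntry_injective (n : ℕ) : Function.Injective (diagEntry n) := by
  intro t t' h
  ext i
  have hi : (i : ℕ) < n := by omega
  have := congrFun h ⟨i, hi⟩
  simpa [diagEntry] using this

theorem exists_diagEntry_eq {n : ℕ} {d : Fin n → ℝ} (hd : ∀ i, 0 < d i) (hprod : ∏ i, d i = 1) :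
    ∃ t, diagEntry n t = d := by
  cases n with
  | zero => exact ⟨fun _ => 0, Subsingleton.elim _ _⟩
  | succ m =>
    refine ⟨fun i => Real.log (d (Fin.castSucc i)), ?_⟩
    ext i
    refine Fin.lastCases ?_ (fun i => ?_) i
    · rw [Fin.prod_univ_castSucc] at hprod
      have hp : 0 < ∏ i : Fin m, d i.castSucc := Finset.prod_pos fun i _ => hd _
      simp only [diagEntry, Fin.val_last, Nat.add_sub_cancel, lt_irrefl, dite_false]
      rw [Real.exp_neg, Real.exp_sum]
      simp only [Real.exp_log (hd _)]
      exact inv_eq_of_mul_eq_one_right hprod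
    · simp only [diagEntry, Fin.val_castSucc, Nat.add_sub_cancel, i.2, dite_true]
      rw [Real.exp_log (hd _)]
      rfl

theorem coe_matA (n : ℕ) (t : Fin (n - 1) → ℝ) :
    (matA n t : Matrix (Fin n) (Fin n) ℝ) = Matrix.diagonal (diagEntry n t) := rfl

theorem coe_matN (n : ℕ) (u : Upper n → ℝ) : (matN n u : Matrix (Fin n) (Fin n) ℝ) =
    Matrix.of fun i j => if h : i < j then u ⟨(i, j), h⟩ else if i = j then 1 else 0 := rfl

theorem matN_apply_lt {n : ℕ} (u : Upper n → ℝ) (p : Upper n) :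
    (matN n u : Matrix (Fin n) (Fin n) ℝ) p.1.1 p.1.2 = u p := by
  rw [coe_matN, Matrix.of_apply, dif_pos p.2]

theorem matN_apply_self {n : ℕ} (u : Upper n → ℝ) (i : Fin n) :
    (matN n u : Matrix (Fin n) (Fin n) ℝ) i i = 1 := by
  rw [coe_matN, Matrix.of_apply, dif_neg (lt_irrefl i), if_pos rfl]

theorem matN_apply_gt {n : ℕ} (u : Upper n → ℝ) {i j : Fin n} (h : j < i) :
    (matN n u : Matrix (Fin n) (Fin n) ℝ) i j = 0 := by
  rw [coe_matN, Matrix.of_apply, dif_neg h.not_gt, if_neg h.ne']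

theorem exists_matN_eq {n : ℕ} {g : G n} (h1 : ∀ i, g i i = 1) (h2 : ∀ i j, j < i → g i j = 0) :
    matN n (fun p => g p.1.1 p.1.2) = g := by
  apply Subtype.ext
  ext i j
  rcases lt_trichotomy i j with h | h | h
  · exact matN_apply_lt _ (⟨(i, j), h⟩ : Upper n)
  · rw [h]; exact (matN_apply_self _ j).trans (h1 j).symm
  · exact (matN_apply_gt _ h).trans (h2 i j h).symm

theorem continuous_toG {n : ℕ} {X : Type*} [TopologicalSpace X] {f : X → G n}
    (h : ∀ i j, Continuous fun x => (f x : Matrix (Fin n) (Fin n) ℝ) i j) : Continuous f :=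
  (isClosedEmbedding_entries n).continuous_iff.2
    (continuous_pi fun i => continuous_pi fun j => h i j)

theorem continuous_matA (n : ℕ) : Continuous (matA n) := by
  refine continuous_toG fun i j => ?_
  simp only [coe_matA, Matrix.diagonal_apply]
  split_ifs
  · exact continuous_diagEntry n i
  · exact continuous_const

theorem continuous_matN (n : ℕ) : Continuous (matN n) := by
  refine continuous_toG fun i j => ?_
  simp only [coe_matN, Matrix.of_apply]
  split_ifs
  · exact continuous_apply _
  · exact continuous_const
  · exact continuous_const

/-- The group `B = AN` of upper triangular matrices with positive diagonal entries. -/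
def B (n : ℕ) : Subgroup (G n) where
  carrier := {g | (∀ i j, j < i → (g : Matrix (Fin n) (Fin n) ℝ) i j = 0) ∧
    ∀ i, 0 < (g : Matrix (Fin n) (Fin n) ℝ) i i}
  mul_mem' := by
    rintro a b ⟨ha, ha'⟩ ⟨hb, hb'⟩
    have hab : ∀ i, ((a * b : G n) : Matrix (Fin n) (Fin n) ℝ) i i =
        (a : Matrix (Fin n) (Fin n) ℝ) i i * (b : Matrix (Fin n) (Fin n) ℝ) i i := by
      intro i
      rw [Matrix.SpecialLinearGroup.coe_mul, Matrix.mul_apply]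
      refine Finset.sum_eq_single i (fun k _ hk => ?_) (by simp)
      rcases lt_or_gt_of_ne hk with h | h
      · rw [ha i k h, zero_mul]
      · rw [hb k i h, mul_zero]
    refine ⟨fun i j hij => ?_, fun i => by rw [hab]; exact mul_pos (ha' i) (hb' i)⟩
    rw [Matrix.SpecialLinearGroup.coe_mul, Matrix.mul_apply]
    refine Finset.sum_eq_zero fun k _ => ?_
    rcases lt_or_ge k i with h | h
    · rw [ha i k h, zero_mul]
    · rw [hb k j (lt_of_lt_of_le hij h), mul_zero]
  one_mem' := by
    refine ⟨fun i j hij => ?_, fun i => ?_⟩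
    · rw [Matrix.SpecialLinearGroup.coe_one, Matrix.one_apply_ne hij.ne']
    · rw [Matrix.SpecialLinearGroup.coe_one, Matrix.one_apply_eq]; exact one_pos
  inv_mem' := by
    rintro a ⟨ha, ha'⟩
    have hmul : (a : Matrix (Fin n) (Fin n) ℝ) * ((a⁻¹ : G n) : Matrix (Fin n) (Fin n) ℝ) = 1 := by
      rw [← Matrix.SpecialLinearGroup.coe_mul, mul_inv_cancel, Matrix.SpecialLinearGroup.coe_one]
    have hinv : (a : Matrix (Fin n) (Fin n) ℝ)⁻¹ = ((a⁻¹ : G n) : Matrix (Fin n) (Fin n) ℝ) :=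
      Matrix.inv_eq_right_inv hmul
    have : Invertible (a : Matrix (Fin n) (Fin n) ℝ) :=
      Matrix.invertibleOfIsUnitDet _ (by simp)
    have htri : ∀ i j, j < i → ((a⁻¹ : G n) : Matrix (Fin n) (Fin n) ℝ) i j = 0 := by
      have h := Matrix.blockTriangular_inv_of_blockTriangular
        (M := (a : Matrix (Fin n) (Fin n) ℝ)) (b := id) (fun i j hij => ha i j hij)
      rw [hinv] at h
      exact fun i j hij => h hij
    refine ⟨htri, fun i => ?_⟩
    have h1 : (a : Matrix (Fin n) (Fin n) ℝ) i i *
        ((a⁻¹ : G n) : Matrix (Fin n) (Fin n) ℝ) i i = 1 := by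
      have h2 := congrFun (congrFun hmul i) i
      rw [Matrix.mul_apply, Matrix.one_apply_eq, Finset.sum_eq_single i (fun k _ hk => ?_)
        (by simp)] at h2
      · exact h2
      · rcases lt_or_gt_of_ne hk with h | h
        · rw [ha i k h, zero_mul]
        · rw [htri k i h, mul_zero]
    exact pos_of_mul_pos_right (by rw [h1]; exact one_pos) (ha' i).le

theorem mem_B_iff {n : ℕ} {g : G n} :
    g ∈ B n ↔ (∀ i j, j < i → (g : Matrix (Fin n) (Fin n) ℝ) i j = 0) ∧
      ∀ i, 0 < (g : Matrix (Fin n) (Fin n) ℝ) i i := Iff.rfl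

/-- The parametrisation `(t, u) ↦ a u` of the group `B`. -/
noncomputable def paramB (n : ℕ) (x : (Fin (n - 1) → ℝ) × (Upper n → ℝ)) : G n :=
  matA n x.1 * matN n x.2

theorem paramB_apply {n : ℕ} (x : (Fin (n - 1) → ℝ) × (Upper n → ℝ)) (i j : Fin n) :
    (paramB n x : Matrix (Fin n) (Fin n) ℝ) i j =
      diagEntry n x.1 i * (matN n x.2 : Matrix (Fin n) (Fin n) ℝ) i j := by
  rw [paramB, Matrix.SpecialLinearGroup.coe_mul, coe_matA, Matrix.diagonal_mul]

theorem continuous_paramB (n : ℕ) : Continuous (paramB n) :=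
  ((continuous_matA n).comp continuous_fst).mul ((continuous_matN n).comp continuous_snd)

theorem paramB_mem (n : ℕ) (x : (Fin (n - 1) → ℝ) × (Upper n → ℝ)) : paramB n x ∈ B n := by
  refine mem_B_iff.2 ⟨fun i j hij => ?_, fun i => ?_⟩
  · rw [paramB_apply, matN_apply_gt _ hij, mul_zero]
  · rw [paramB_apply, matN_apply_self, mul_one]; exact diagEntry_pos n _ i

theorem paramB_injective (n : ℕ) : Function.Injective (paramB n) := by
  rintro ⟨t, u⟩ ⟨t', u'⟩ h
  have h1 : ∀ i j, diagEntry n t i * (matN n u : Matrix (Fin n) (Fin n) ℝ) i j =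
      diagEntry n t' i * (matN n u' : Matrix (Fin n) (Fin n) ℝ) i j := by
    intro i j
    have := paramB_apply (t, u) i j
    rw [h, paramB_apply] at this
    exact this.symm
  have ht : t = t' := by
    apply diagEntry_injective n
    ext i
    simpa [matN_apply_self] using h1 i i
  subst ht
  refine Prod.ext rfl ?_
  ext p
  have := h1 p.1.1 p.1.2
  rw [matN_apply_lt, matN_apply_lt] at this
  exact mul_left_cancel₀ (diagEntry_pos n t p.1.1).ne' this

theorem exists_matA_eq {n : ℕ} (a : G n) {d : Fin n → ℝ} (hd : ∀ i, 0 < d i)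
    (ha : (a : Matrix (Fin n) (Fin n) ℝ) = Matrix.diagonal d) : ∃ t, diagEntry n t = d ∧
      matA n t = a := by
  have hprod : ∏ i, d i = 1 := by rw [← Matrix.det_diagonal, ← ha]; exact a.det_coe
  obtain ⟨t, ht⟩ := exists_diagEntry_eq hd hprod
  exact ⟨t, ht, Subtype.ext (by rw [coe_matA, ht]; exact ha.symm)⟩

theorem exists_paramB_eq {n : ℕ} {g : G n} (hg : g ∈ B n) : ∃ x, paramB n x = g := by
  obtain ⟨h1, h2⟩ := mem_B_iff.1 hg
  have hprod : ∏ i, (g : Matrix (Fin n) (Fin n) ℝ) i i = 1 := by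
    rw [← Matrix.det_of_isUpperTriangular (fun i j hij => h1 i j hij)]; exact g.det_coe
  obtain ⟨t, ht⟩ := exists_diagEntry_eq h2 hprod
  refine ⟨(t, fun p => (g : Matrix (Fin n) (Fin n) ℝ) p.1.1 p.1.2 /
    (g : Matrix (Fin n) (Fin n) ℝ) p.1.1 p.1.1), Subtype.ext ?_⟩
  ext i j
  rw [paramB_apply, ht]
  rcases lt_trichotomy i j with h | h | h
  · rw [matN_apply_lt _ (⟨(i, j), h⟩ : Upper n)]
    exact mul_div_cancel₀ _ (h2 i).ne'
  · rw [h, matN_apply_self, mul_one]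
  · rw [matN_apply_gt _ h, mul_zero, h1 i j h]

theorem K_inf_B {n : ℕ} {g : G n} (hK : g ∈ K n) (hB : g ∈ B n) : g = 1 := by
  have hinv : ((g⁻¹ : G n) : Matrix (Fin n) (Fin n) ℝ) = (g : Matrix (Fin n) (Fin n) ℝ)ᵀ := by
    have h1 : (g : Matrix (Fin n) (Fin n) ℝ) * ((g⁻¹ : G n) : Matrix (Fin n) (Fin n) ℝ) = 1 := by
      rw [← Matrix.SpecialLinearGroup.coe_mul, mul_inv_cancel, Matrix.SpecialLinearGroup.coe_one]
    exact (left_inv_eq_right_inv (mem_K_iff.1 hK) h1).symm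
  obtain ⟨h1, h2⟩ := mem_B_iff.1 hB
  have h3 := (mem_B_iff.1 ((B n).inv_mem hB)).1
  rw [hinv] at h3
  have hdiag : (g : Matrix (Fin n) (Fin n) ℝ) =
      Matrix.diagonal fun i => (g : Matrix (Fin n) (Fin n) ℝ) i i := by
    ext i j
    rcases lt_trichotomy i j with h | h | h
    · rw [Matrix.diagonal_apply_ne _ h.ne]; exact h3 j i h
    · rw [h, Matrix.diagonal_apply_eq]
    · rw [Matrix.diagonal_apply_ne _ h.ne']; exact h1 i j h
  apply Subtype.ext
  show (g : Matrix (Fin n) (Fin n) ℝ) = 1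
  rw [hdiag, ← Matrix.diagonal_one]
  congr 1
  ext i
  have h4 := mem_K_iff.1 hK
  rw [hdiag, Matrix.diagonal_transpose, Matrix.diagonal_mul_diagonal] at h4
  have h5 := congrFun (congrFun h4 i) i
  rw [Matrix.diagonal_apply_eq, Matrix.one_apply_eq] at h5
  nlinarith [h2 i]

/-- The Iwasawa decomposition: existence. -/
theorem exists_iwasawa {n : ℕ} (g : G n) : ∃ k ∈ K n, ∃ b ∈ B n, g = k * b := by
  obtain ⟨u, d, hu, hd, h⟩ := exists_unipotent_congruence n _ (posDef_gram g)
  obtain ⟨k, hk, a, ha, heq⟩ := exists_orthogonal_of_gram g hu hd h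
  refine ⟨k, hk, a * unipotentSL u hu, (B n).mul_mem ?_ ?_, by rw [heq, mul_assoc]⟩
  · refine mem_B_iff.2 ⟨fun i j hij => ?_, fun i => ?_⟩
    · rw [ha, Matrix.diagonal_apply_ne _ hij.ne']
    · rw [ha, Matrix.diagonal_apply_eq]; exact Real.sqrt_pos.2 (hd i)
  · refine mem_B_iff.2 ⟨hu.2, fun i => ?_⟩
    show 0 < u i i
    rw [hu.1]; exact one_pos

theorem iwasawa_unique {n : ℕ} {k k' b b' : G n} (hk : k ∈ K n) (hk' : k' ∈ K n) (hb : b ∈ B n)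
    (hb' : b' ∈ B n) (h : k * b = k' * b') : k = k' ∧ b = b' := by
  have h1 : k'⁻¹ * k = b' * b⁻¹ := by
    rw [eq_mul_inv_iff_mul_eq, mul_assoc, h, inv_mul_cancel_left]
  have h2 : k'⁻¹ * k = 1 := K_inf_B ((K n).mul_mem ((K n).inv_mem hk') hk)
    (h1 ▸ (B n).mul_mem hb' ((B n).inv_mem hb))
  have h3 : k = k' := (inv_mul_eq_one.1 h2).symm
  subst h3
  exact ⟨rfl, mul_left_cancel h⟩

/-! ### Invariance of the coordinate measure on `B` -/

theorem density_pos (n : ℕ) (t : Fin (n - 1) → ℝ) : 0 < density n t :=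
  Finset.prod_pos fun _ _ => div_pos (diagEntry_pos n t _) (diagEntry_pos n t _)

theorem density_add (n : ℕ) (t t' : Fin (n - 1) → ℝ) :
    density n (t + t') = density n t * density n t' := by
  rw [density, density, density, ← Finset.prod_mul_distrib]
  refine Finset.prod_congr rfl fun p _ => ?_
  rw [diagEntry_add, diagEntry_add, mul_div_mul_comm]

theorem continuous_density (n : ℕ) : Continuous (density n) :=
  continuous_finsetProd _ fun p _ => (continuous_diagEntry n p.1.1).div
    (continuous_diagEntry n p.1.2) fun t => (diagEntry_pos n t _).ne'

/-- The measure `∏_{i<j} (a_i / a_j) da` on `A`, in logarithmic coordinates. -/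
noncomputable def measA (n : ℕ) : Measure (Fin (n - 1) → ℝ) :=
  (volume : Measure (Fin (n - 1) → ℝ)).withDensity fun t => ENNReal.ofReal (density n t)

/-- The measure `∏_{i<j} (a_i / a_j) da du`, a right Haar measure of `B` in coordinates. -/
noncomputable def measB (n : ℕ) : Measure ((Fin (n - 1) → ℝ) × (Upper n → ℝ)) :=
  (measA n).prod volume

instance (n : ℕ) : SigmaFinite (measA n) :=
  SigmaFinite.withDensity_ofReal _

instance (n : ℕ) : SigmaFinite (measB n) := by unfold measB; infer_instance

theorem sum_upper {n : ℕ} (i : Fin n) (f : Fin n → ℝ) (u : Upper n → ℝ) :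
    ∑ k, (matN n u : Matrix (Fin n) (Fin n) ℝ) i k * f k =
      f i + ∑ q : Upper n, (if q.1.1 = i then f q.1.2 else 0) * u q := by
  have h1 : ∀ k, (matN n u : Matrix (Fin n) (Fin n) ℝ) i k * f k =
      (if k = i then f i else 0) + if h : i < k then u ⟨(i, k), h⟩ * f k else 0 := by
    intro k
    rcases lt_trichotomy i k with h | h | h
    · rw [if_neg h.ne', dif_pos h, zero_add, matN_apply_lt u (⟨(i, k), h⟩ : Upper n)]
    · subst h; simp [matN_apply_self]
    · rw [if_neg h.ne, dif_neg h.not_gt, matN_apply_gt _ h]; simp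
  rw [Finset.sum_congr rfl fun k _ => h1 k, Finset.sum_add_distrib, Finset.sum_ite_eq']
  simp only [Finset.mem_univ, if_true]
  congr 1
  have h2 : ∑ q : Upper n, (if q.1.1 = i then f q.1.2 else 0) * u q =
      ∑ p : Fin n × Fin n, if h : p.1 < p.2 then
        (if p.1 = i then f p.2 else 0) * u ⟨p, h⟩ else 0 := by
    rw [← Finset.sum_subset (Finset.subset_univ (Finset.univ.filter fun p : Fin n × Fin n =>
      p.1 < p.2)) (fun p _ hp => dif_neg (by simpa using hp))]
    rw [Finset.sum_subtype (p := fun p : Fin n × Fin n => p.1 < p.2) _ (by simp)]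
    exact Finset.sum_congr rfl fun q _ => by rw [dif_pos q.2]
  rw [h2, Fintype.sum_prod_type]
  symm
  rw [Finset.sum_eq_single i]
  · refine Finset.sum_congr rfl fun k _ => ?_
    by_cases h : i < k
    · simp [h, mul_comm]
    · simp [h]
  · intro b _ hb
    exact Finset.sum_eq_zero fun k _ => by simp [hb]
  · simp

/-- The coordinates of `N(u) N(u₀)`. -/
noncomputable def mulN {n : ℕ} (u₀ u : Upper n → ℝ) : Upper n → ℝ :=
  fun p => ((matN n u * matN n u₀ : G n) : Matrix (Fin n) (Fin n) ℝ) p.1.1 p.1.2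

theorem matN_mul {n : ℕ} (u₀ u : Upper n → ℝ) : matN n (mulN u₀ u) = matN n u * matN n u₀ := by
  have hentry : ∀ i j, j ≤ i → ((matN n u * matN n u₀ : G n) : Matrix (Fin n) (Fin n) ℝ) i j =
      if j = i then 1 else 0 := by
    intro i j hij
    rw [Matrix.SpecialLinearGroup.coe_mul, Matrix.mul_apply, sum_upper]
    rw [Finset.sum_eq_zero, add_zero]
    · split_ifs with h
      · rw [h, matN_apply_self]
      · exact matN_apply_gt _ (lt_of_le_of_ne hij h)
    · intro q _
      split_ifs with h
      · rw [matN_apply_gt _ (lt_of_le_of_lt hij (h ▸ q.2)), zero_mul]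
      · rw [zero_mul]
  exact exists_matN_eq (fun i => by rw [hentry i i le_rfl, if_pos rfl])
    fun i j hij => by rw [hentry i j hij.le, if_neg hij.ne]

/-- Right translation of `N` is, in coordinates, a unipotent affine map, so it preserves Lebesgue
measure. -/
theorem measurePreserving_mulN {n : ℕ} (u₀ : Upper n → ℝ) :
    MeasurePreserving (mulN u₀) volume volume := by
  let M : Matrix (Upper n) (Upper n) ℝ := Matrix.of fun p q =>
    if q.1.1 = p.1.1 then (matN n u₀ : Matrix (Fin n) (Fin n) ℝ) q.1.2 p.1.2 else 0
  have hdet : M.det = 1 := by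
    have hM : M.BlockTriangular fun p : Upper n => OrderDual.toDual p.1.2 := by
      intro p q hpq
      simp only [M, Matrix.of_apply]
      split_ifs
      · exact matN_apply_gt _ hpq
      · rfl
    rw [hM.det]
    refine Finset.prod_eq_one fun k _ => ?_
    have : M.toSquareBlock (fun p : Upper n => OrderDual.toDual p.1.2) k = 1 := by
      ext ⟨p, hp⟩ ⟨q, hq⟩
      have hpq : p.1.2 = q.1.2 := OrderDual.toDual.injective (hp.trans hq.symm)
      simp only [Matrix.toSquareBlock_def, Matrix.of_apply, M, Matrix.one_apply, hpq,
        matN_apply_self, Subtype.mk.injEq]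
      have : q.1.1 = p.1.1 ↔ p = q :=
        ⟨fun h => Subtype.ext (Prod.ext h.symm hpq), fun h => by rw [h]⟩
      simp only [this]
    rw [this, Matrix.det_one]
  have hmul : mulN u₀ = (fun x => u₀ + x) ∘ Matrix.toLin' M := by
    ext u p
    rw [mulN, Matrix.SpecialLinearGroup.coe_mul, Matrix.mul_apply, sum_upper, matN_apply_lt]
    rfl
  have hlin : MeasurePreserving (Matrix.toLin' M) volume volume := by
    refine ⟨(Matrix.toLin' M).continuous_of_finiteDimensional.measurable, ?_⟩
    rw [Real.map_matrix_volume_pi_eq_smul_volume_pi (by rw [hdet]; exact one_ne_zero), hdet]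
    simp
  rw [hmul]
  exact (measurePreserving_add_left volume u₀).comp hlin

theorem paramB_mul_matN {n : ℕ} (x : (Fin (n - 1) → ℝ) × (Upper n → ℝ)) (u₀ : Upper n → ℝ) :
    paramB n x * matN n u₀ = paramB n (Prod.map id (mulN u₀) x) := by
  rw [paramB, paramB, Prod.map_fst, Prod.map_snd, matN_mul, mul_assoc]; rfl

theorem map_measB_mulN {n : ℕ} (u₀ : Upper n → ℝ) :
    (measB n).map (Prod.map id (mulN u₀)) = measB n := by
  rw [measB, ← Measure.map_prod_map _ _ measurable_id (measurePreserving_mulN u₀).measurable,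
    (measurePreserving_mulN u₀).map_eq, Measure.map_id]

/-- Conjugation by `a = diag(a_i)` in coordinates: `u_{ij} ↦ u_{ij} a_j / a_i`. -/
noncomputable def conjN {n : ℕ} (t₀ : Fin (n - 1) → ℝ) (u : Upper n → ℝ) : Upper n → ℝ :=
  fun p => (diagEntry n t₀ p.1.2 / diagEntry n t₀ p.1.1) * u p

theorem paramB_mul_matA {n : ℕ} (x : (Fin (n - 1) → ℝ) × (Upper n → ℝ)) (t₀ : Fin (n - 1) → ℝ) :
    paramB n x * matA n t₀ = paramB n (Prod.map (fun t => t + t₀) (conjN t₀) x) := by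
  apply Subtype.ext
  ext i j
  rw [Matrix.SpecialLinearGroup.coe_mul, coe_matA, Matrix.mul_diagonal, paramB_apply, paramB_apply,
    Prod.map_fst, Prod.map_snd, diagEntry_add]
  have hp := (diagEntry_pos n t₀ i).ne'
  rcases lt_trichotomy i j with h | h | h
  · rw [matN_apply_lt _ (⟨(i, j), h⟩ : Upper n), matN_apply_lt _ (⟨(i, j), h⟩ : Upper n), conjN]
    field_simp
  · subst h; rw [matN_apply_self, matN_apply_self]; ring
  · rw [matN_apply_gt _ h, matN_apply_gt _ h]; ring

theorem map_conjN {n : ℕ} (t₀ : Fin (n - 1) → ℝ) :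
    (volume : Measure (Upper n → ℝ)).map (conjN t₀) =
      ENNReal.ofReal (density n t₀) • volume := by
  set D : Upper n → ℝ := fun p => diagEntry n t₀ p.1.2 / diagEntry n t₀ p.1.1 with hD
  have h1 : conjN t₀ = Matrix.toLin' (Matrix.diagonal D) := by
    ext u p
    rw [Matrix.toLin'_apply, Matrix.mulVec_diagonal]; rfl
  have hpos : 0 < ∏ p, D p := Finset.prod_pos fun p _ =>
    div_pos (diagEntry_pos n t₀ _) (diagEntry_pos n t₀ _)
  have h2 : (∏ p, D p)⁻¹ = density n t₀ := by
    rw [density, ← Finset.prod_inv_distrib]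
    exact Finset.prod_congr rfl fun p _ => inv_div _ _
  rw [h1, Real.map_matrix_volume_pi_eq_smul_volume_pi (by rw [Matrix.det_diagonal]; exact hpos.ne'),
    Matrix.det_diagonal, h2, abs_of_pos (density_pos n t₀)]

theorem map_measA_add {n : ℕ} (t₀ : Fin (n - 1) → ℝ) :
    (measA n).map (fun t => t + t₀) = (ENNReal.ofReal (density n t₀))⁻¹ • measA n := by
  have hmeas : Measurable fun t => ENNReal.ofReal (density n t) :=
    (continuous_density n).measurable.ennreal_ofReal
  have hc0 : ENNReal.ofReal (density n t₀) ≠ 0 := by simpa using density_pos n t₀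
  ext s hs
  rw [Measure.map_apply (measurable_add_const t₀) hs, Measure.smul_apply, smul_eq_mul, measA,
    withDensity_apply _ hs, withDensity_apply _ (measurable_add_const t₀ hs)]
  have h := (measurePreserving_add_right (volume : Measure (Fin (n - 1) → ℝ)) t₀)
    |>.setLIntegral_comp_preimage hs hmeas
  rw [← h]
  simp only [density_add, ENNReal.ofReal_mul (density_pos n _).le]
  rw [lintegral_mul_const _ hmeas, mul_comm (ENNReal.ofReal (density n t₀))⁻¹, mul_assoc,
    ENNReal.mul_inv_cancel hc0 ENNReal.ofReal_ne_top, mul_one]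

theorem map_measB_mulA {n : ℕ} (t₀ : Fin (n - 1) → ℝ) :
    (measB n).map (Prod.map (fun t => t + t₀) (conjN t₀)) = measB n := by
  have hc0 : ENNReal.ofReal (density n t₀) ≠ 0 := by simpa using density_pos n t₀
  have hconj : Measurable (conjN (n := n) t₀) := by unfold conjN; fun_prop
  rw [measB, ← Measure.map_prod_map _ _ (measurable_add_const t₀) hconj, map_conjN, map_measA_add,
    Measure.prod_smul_left, Measure.prod_smul_right, smul_smul, ENNReal.inv_mul_cancel hc0
    ENNReal.ofReal_ne_top, one_smul]

/-! ### The Iwasawa measure is a Haar measure -/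

theorem isClosed_K (n : ℕ) : IsClosed ((K n : Subgroup (G n)) : Set (G n)) :=
  (isCompact_iff_compactSpace.2 (instCompactSpaceK n)).isClosed

theorem measurableSet_B (n : ℕ) : MeasurableSet ((B n : Subgroup (G n)) : Set (G n)) := by
  have hcont : ∀ i j : Fin n, Continuous fun g : G n => (g : Matrix (Fin n) (Fin n) ℝ) i j :=
    fun i j => (continuous_apply_apply i j).comp (isClosedEmbedding_entries n).continuous
  have : ((B n : Subgroup (G n)) : Set (G n)) =
      (⋂ i, ⋂ j, {g : G n | j < i → (g : Matrix (Fin n) (Fin n) ℝ) i j = 0}) ∩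
        ⋂ i, {g : G n | 0 < (g : Matrix (Fin n) (Fin n) ℝ) i i} := by
    ext g
    simp only [Set.mem_inter_iff, Set.mem_iInter, Set.mem_ofPred_eq]
    exact mem_B_iff
  rw [this]
  refine (MeasurableSet.iInter fun i => MeasurableSet.iInter fun j => ?_).inter
    (MeasurableSet.iInter fun i => (isOpen_lt continuous_const (hcont i i)).measurableSet)
  by_cases h : j < i
  · simp only [h, true_imp_iff]
    exact (isClosed_eq (hcont i j) continuous_const).measurableSet
  · simp [h]

instance (n : ℕ) : SecondCountableTopology (K n) :=
  TopologicalSpace.Subtype.secondCountableTopology _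

instance (n : ℕ) : SecondCountableTopology (B n) :=
  TopologicalSpace.Subtype.secondCountableTopology _

/-- The coordinates `K × B → SL_n(ℝ)`, `(k, b) ↦ k b⁻¹`, in which left translations of the group
`K × B` become left translations by `K` and right translations by `B`. -/
def iwasawaInv (n : ℕ) (x : K n × B n) : G n := (x.1 : G n) * (x.2 : G n)⁻¹

theorem iwasawaInv_bijective (n : ℕ) : Function.Bijective (iwasawaInv n) := by
  constructor
  · rintro ⟨k, b⟩ ⟨k', b'⟩ h
    obtain ⟨h1, h2⟩ := iwasawa_unique k.2 k'.2 ((B n).inv_mem b.2) ((B n).inv_mem b'.2) h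
    exact Prod.ext (Subtype.ext h1) (Subtype.ext (inv_injective h2))
  · intro g
    obtain ⟨k, hk, b, hb, rfl⟩ := exists_iwasawa g
    exact ⟨(⟨k, hk⟩, ⟨b⁻¹, (B n).inv_mem hb⟩), by simp [iwasawaInv]⟩

/-- A bijective measurable map from a standard Borel space, as a measurable equivalence. -/
noncomputable def equivOfBijective {α β : Type*} [MeasurableSpace α] [StandardBorelSpace α]
    [MeasurableSpace β] [MeasurableSpace.CountablySeparated β] (f : α → β) (hf : Measurable f)
    (hbij : Function.Bijective f) : α ≃ᵐ β where
  toEquiv := Equiv.ofBijective f hbij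
  measurable_toFun := hf
  measurable_invFun := by
    intro s hs
    have h := (hf.measurableEmbedding hbij.1).measurableSet_image' hs
    rwa [show f '' s = (Equiv.ofBijective f hbij).symm ⁻¹' s from
      (Equiv.ofBijective f hbij).image_eq_preimage_symm s] at h

instance (n : ℕ) : StandardBorelSpace (K n) :=
  (isClosed_K n).measurableSet.standardBorel

instance (n : ℕ) : StandardBorelSpace (B n) :=
  (measurableSet_B n).standardBorel

theorem measurable_iwasawaInv (n : ℕ) : Measurable (iwasawaInv n) :=
  (measurable_subtype_coe.comp measurable_fst).mul
    (measurable_subtype_coe.comp measurable_snd).inv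

/-- Uniqueness of the measure on `SL_n(ℝ)` that is left `K`-invariant and right `B`-invariant: the
group `K × B^{op}` acts simply transitively, and Haar measures are unique up to scaling. -/
theorem eq_smul_of_invariant {n : ℕ} (μ ν : Measure (G n)) [SigmaFinite μ] [SigmaFinite ν]
    (hμK : ∀ k ∈ K n, μ.map (fun g => k * g) = μ) (hμB : ∀ b ∈ B n, μ.map (fun g => g * b) = μ)
    (hνK : ∀ k ∈ K n, ν.map (fun g => k * g) = ν) (hνB : ∀ b ∈ B n, ν.map (fun g => g * b) = ν)
    {s : Set (G n)} (hs0 : ν s ≠ 0) (hs1 : ν s ≠ ⊤) : μ = (μ s / ν s) • ν := by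
  let e : (K n × B n) ≃ᵐ G n :=
    equivOfBijective (iwasawaInv n) (measurable_iwasawaInv n) (iwasawaInv_bijective n)
  have hinv : ∀ ρ : Measure (G n), (∀ k ∈ K n, ρ.map (fun g => k * g) = ρ) →
      (∀ b ∈ B n, ρ.map (fun g => g * b) = ρ) → (ρ.map e.symm).IsMulLeftInvariant := by
    intro ρ hK hB
    refine ⟨fun x => ?_⟩
    have hcomm : (fun y => x * y) ∘ e.symm =
        e.symm ∘ (fun g : G n => g * (x.2 : G n)⁻¹) ∘ fun g : G n => (x.1 : G n) * g := by
      ext1 g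
      obtain ⟨y, rfl⟩ := e.surjective g
      apply e.injective
      simp only [Function.comp, MeasurableEquiv.symm_apply_apply, MeasurableEquiv.apply_symm_apply]
      show ((x.1 * y.1 : K n) : G n) * ((x.2 * y.2 : B n) : G n)⁻¹ =
        (x.1 : G n) * ((y.1 : G n) * (y.2 : G n)⁻¹) * (x.2 : G n)⁻¹
      rw [Subgroup.coe_mul, Subgroup.coe_mul, _root_.mul_inv_rev]
      simp only [mul_assoc]
    rw [Measure.map_map (measurable_const_mul x) e.symm.measurable, hcomm,
      ← Measure.map_map e.symm.measurable
        ((measurable_mul_const _).comp (measurable_const_mul _)),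
      ← Measure.map_map (measurable_mul_const _) (measurable_const_mul _), hK _ x.1.2,
      hB _ ((B n).inv_mem x.2.2)]
  have := hinv μ hμK hμB
  have := hinv ν hνK hνB
  have : SigmaFinite (μ.map e.symm) := e.symm.sigmaFinite_map
  have : SigmaFinite (ν.map e.symm) := e.symm.sigmaFinite_map
  have hval : ∀ ρ : Measure (G n), (ρ.map e.symm) (e ⁻¹' s) = ρ s := by
    intro ρ
    rw [e.symm.map_apply, ← Set.preimage_comp, MeasurableEquiv.self_comp_symm, Set.preimage_id]
  have h := measure_eq_div_smul (μ.map e.symm) (ν.map e.symm) (s := e ⁻¹' s)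
    (by rwa [hval]) (by rwa [hval])
  rw [hval, hval] at h
  have h2 := congrArg (Measure.map e) h
  rw [Measure.map_smul] at h2
  simpa only [e.map_map_symm] using h2

/-- The Iwasawa coordinates `(k, t, u) ↦ k a u`. -/
noncomputable def iwasawa (n : ℕ) (x : K n × ((Fin (n - 1) → ℝ) × (Upper n → ℝ))) : G n :=
  (x.1 : G n) * paramB n x.2

theorem continuous_iwasawa (n : ℕ) : Continuous (iwasawa n) :=
  (continuous_subtype_val.comp continuous_fst).mul ((continuous_paramB n).comp continuous_snd)

theorem iwasawa_bijective (n : ℕ) : Function.Bijective (iwasawa n) := by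
  constructor
  · rintro ⟨k, x⟩ ⟨k', x'⟩ h
    obtain ⟨h1, h2⟩ := iwasawa_unique k.2 k'.2 (paramB_mem n x) (paramB_mem n x') h
    exact Prod.ext (Subtype.ext h1) (paramB_injective n h2)
  · intro g
    obtain ⟨k, hk, b, hb, rfl⟩ := exists_iwasawa g
    obtain ⟨x, rfl⟩ := exists_paramB_eq hb
    exact ⟨(⟨k, hk⟩, x), rfl⟩

/-- The Iwasawa coordinates as a measurable equivalence. -/
noncomputable def iwasawaEquiv (n : ℕ) :
    (K n × ((Fin (n - 1) → ℝ) × (Upper n → ℝ))) ≃ᵐ G n :=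
  equivOfBijective (iwasawa n) (continuous_iwasawa n).measurable (iwasawa_bijective n)

theorem vol_eq_map (n : ℕ) : vol n = ((muK n).prod (measB n)).map (iwasawaEquiv n) := by
  have : (iwasawaEquiv n : _ → G n) =
      fun x => (x.1 : G n) * matA n x.2.1 * matN n x.2.2 := by
    ext1 x
    show (x.1 : G n) * (matA n x.2.1 * matN n x.2.2) = _
    rw [mul_assoc]
  rw [this]; rfl

instance (n : ℕ) : IsFiniteMeasure (muK n) := by
  unfold muK
  exact Measure.smul_finite _ ENNReal.ofReal_ne_top

instance (n : ℕ) : (muK n).IsMulLeftInvariant := by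
  unfold muK; infer_instance

instance (n : ℕ) : SigmaFinite (vol n) := by
  rw [vol_eq_map]; exact (iwasawaEquiv n).sigmaFinite_map

theorem vol_map_left {n : ℕ} {k : G n} (hk : k ∈ K n) : (vol n).map (fun g => k * g) = vol n := by
  rw [vol_eq_map, Measure.map_map (measurable_const_mul k) (iwasawaEquiv n).measurable]
  have hcomm : (fun g => k * g) ∘ iwasawaEquiv n =
      iwasawaEquiv n ∘ Prod.map (fun x : K n => (⟨k, hk⟩ : K n) * x) id := by
    ext1 x
    show k * ((x.1 : G n) * paramB n x.2) = ((⟨k, hk⟩ * x.1 : K n) : G n) * paramB n x.2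
    rw [Subgroup.coe_mul, mul_assoc]
  rw [hcomm, ← Measure.map_map (iwasawaEquiv n).measurable
    ((measurable_const_mul _).prodMap measurable_id),
    ← Measure.map_prod_map _ _ (measurable_const_mul _) measurable_id, Measure.map_id,
    map_mul_left_eq_self]

theorem vol_map_right_of_param {n : ℕ} {b : G n}
    {F : (Fin (n - 1) → ℝ) × (Upper n → ℝ) → (Fin (n - 1) → ℝ) × (Upper n → ℝ)}
    (hF : Measurable F) (h : ∀ x, paramB n x * b = paramB n (F x))
    (hmap : (measB n).map F = measB n) : (vol n).map (fun g => g * b) = vol n := by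
  rw [vol_eq_map, Measure.map_map (measurable_mul_const b) (iwasawaEquiv n).measurable]
  have hcomm : (fun g => g * b) ∘ iwasawaEquiv n =
      iwasawaEquiv n ∘ Prod.map (id : K n → K n) F := by
    ext1 x
    show (x.1 : G n) * paramB n x.2 * b = (x.1 : G n) * paramB n (F x.2)
    rw [mul_assoc, h]
  rw [hcomm, ← Measure.map_map (iwasawaEquiv n).measurable (measurable_id.prodMap hF),
    ← Measure.map_prod_map _ _ measurable_id hF, Measure.map_id, hmap]

theorem vol_map_right {n : ℕ} {b : G n} (hb : b ∈ B n) : (vol n).map (fun g => g * b) = vol n := by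
  obtain ⟨x, rfl⟩ := exists_paramB_eq hb
  have h1 : (vol n).map (fun g => g * matA n x.1) = vol n :=
    vol_map_right_of_param ((measurable_add_const _).prodMap (by unfold conjN; fun_prop))
      (fun y => paramB_mul_matA y x.1) (map_measB_mulA x.1)
  have h2 : (vol n).map (fun g => g * matN n x.2) = vol n :=
    vol_map_right_of_param (measurable_id.prodMap (measurePreserving_mulN x.2).measurable)
      (fun y => paramB_mul_matN y x.2) (map_measB_mulN x.2)
  have hcomp : (fun g => g * paramB n x) = (fun g => g * matN n x.2) ∘ fun g => g * matA n x.1 := by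
    ext1 g; simp only [Function.comp, paramB, mul_assoc]
  rw [hcomp, ← Measure.map_map (measurable_mul_const _) (measurable_mul_const _), h1, h2]

theorem sphereVol_pos {i : ℕ} (hi : i ≠ 0) : 0 < sphereVol i := by
  have : (0 : ℝ) < i := by positivity
  have := Real.Gamma_pos_of_pos (half_pos this)
  unfold sphereVol; positivity

theorem volSO_pos (n : ℕ) : 0 < volSO n :=
  Finset.prod_pos fun i hi => mul_pos (by positivity)
    (sphereVol_pos (by have := (Finset.mem_Icc.1 hi).1; omega))

theorem muK_univ (n : ℕ) : muK n Set.univ = ENNReal.ofReal (volSO n) := by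
  have h := Measure.haarMeasure_self (K₀ := (⊤ : TopologicalSpace.PositiveCompacts (K n)))
  rw [TopologicalSpace.PositiveCompacts.coe_top] at h
  rw [muK, Measure.smul_apply, h, smul_eq_mul, mul_one]

theorem vol_ne_zero (n : ℕ) : vol n ≠ 0 := by
  have hA : measA n ≠ 0 := by
    intro h
    rw [measA, withDensity_eq_zero_iff (by
      exact (continuous_density n).measurable.ennreal_ofReal.aemeasurable)] at h
    have h2 : ∀ᵐ t : Fin (n - 1) → ℝ, False := by
      filter_upwards [h] with t ht
      have : density n t ≤ 0 := by simpa using ht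
      exact absurd (density_pos n t) this.not_gt
    have h3 : (volume : Measure (Fin (n - 1) → ℝ)) Set.univ ≠ 0 :=
      (isOpen_univ.measure_pos volume Set.univ_nonempty).ne'
    exact h3 (by simpa [ae_iff] using h2)
  have hU : (volume : Measure (Upper n → ℝ)) Set.univ ≠ 0 :=
    (isOpen_univ.measure_pos volume Set.univ_nonempty).ne'
  intro h
  have h1 : (vol n) Set.univ = 0 := by rw [h]; rfl
  rw [vol_eq_map, (iwasawaEquiv n).map_apply, Set.preimage_univ, ← Set.univ_prod_univ,
    Measure.prod_prod, measB, ← Set.univ_prod_univ, Measure.prod_prod, muK_univ] at h1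
  simp only [mul_eq_zero, ENNReal.ofReal_eq_zero, (volSO_pos n).not_ge, hU, or_false,
    Measure.measure_univ_eq_zero, hA] at h1

/-- The Iwasawa measure is a multiple of the cone measure. -/
theorem exists_coneMeasure_smul (n : ℕ) [NeZero n] :
    ∃ c : ENNReal, c ≠ 0 ∧ c ≠ ⊤ ∧ vol n = c • coneMeasure n := by
  obtain ⟨C, hC, hC1⟩ := exists_compact_mem_nhds (1 : G n)
  have hC0 : coneMeasure n C ≠ 0 := (Measure.measure_pos_of_mem_nhds _ hC1).ne'
  have hCt : coneMeasure n C ≠ ⊤ := hC.measure_lt_top.ne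
  have h := eq_smul_of_invariant (vol n) (coneMeasure n) (fun k hk => vol_map_left hk)
    (fun b hb => vol_map_right hb) (fun k _ => map_mul_left_eq_self _ k)
    (fun b _ => map_mul_right_eq_self _ b) hC0 hCt
  refine ⟨_, ?_, ?_, h⟩
  · intro hc
    rw [hc, zero_smul] at h
    exact vol_ne_zero n h
  · intro hc
    rw [hc] at h
    -- a measure with values in `{0, ∞}` that is σ-finite vanishes
    obtain ⟨s, -, -, hs0, hst⟩ := Measure.exists_subset_measure_lt_top MeasurableSet.univ
      (Measure.measure_univ_pos.2 (vol_ne_zero n))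
    rw [h, Measure.smul_apply, smul_eq_mul] at hs0 hst
    by_cases hs : coneMeasure n s = 0
    · simp [hs] at hs0
    · simp [ENNReal.top_mul hs] at hst

theorem isHaarMeasure_vol (n : ℕ) [NeZero n] : (vol n).IsHaarMeasure := by
  obtain ⟨c, hc0, hct, h⟩ := exists_coneMeasure_smul n
  rw [h]
  exact Measure.IsHaarMeasure.smul _ hc0 hct

theorem isMulRightInvariant_vol (n : ℕ) [NeZero n] : (vol n).IsMulRightInvariant := by
  obtain ⟨c, -, -, h⟩ := exists_coneMeasure_smul n
  rw [h]
  infer_instance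

theorem isInvInvariant_vol (n : ℕ) [NeZero n] : (vol n).IsInvInvariant := by
  have := isHaarMeasure_vol n
  have := isMulRightInvariant_vol n
  exact isInvInvariant_of_biinvariant (vol n)

/-! ### Fundamental domains -/

/-- A discrete subgroup of a second countable group has a Borel fundamental domain for left
translations: cover the group by countably many open sets `U x_k` that meet each orbit at most
once, and keep in each of them only the orbits that no earlier one meets. -/
theorem exists_isFundamentalDomain {H : Type*} [Group H] [TopologicalSpace H]
    [IsTopologicalGroup H] [SecondCountableTopology H] [MeasurableSpace H] [BorelSpace H]
    (Γ : Subgroup H) {W : Set H} (hW : W ∈ nhds (1 : H)) (hΓ : ∀ γ ∈ Γ, γ ∈ W → γ = 1)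
    (μ : Measure H) : ∃ F : Set H, IsFundamentalDomain Γ F μ := by
  obtain ⟨U₀, hU₀, hdiv⟩ := exists_nhds_split_inv hW
  obtain ⟨U, hUsub, hUo, hU1⟩ := mem_nhds_iff.1 hU₀
  let V : H → Set H := fun x => (fun g => g * x⁻¹) ⁻¹' U
  have hVo : ∀ x, IsOpen (V x) := fun x => hUo.preimage (continuous_mul_const _)
  have hVx : ∀ x, x ∈ V x := fun x => by simpa [V] using hU1
  have hVinj : ∀ x g, ∀ γ ∈ Γ, g ∈ V x → γ * g ∈ V x → γ = 1 := by
    intro x g γ hγ h1 h2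
    apply hΓ γ hγ
    have := hdiv _ (hUsub h2) _ (hUsub h1)
    simpa [div_eq_mul_inv, mul_assoc] using this
  obtain ⟨S, hS, hScov⟩ := TopologicalSpace.countable_cover_nhds
    (f := V) fun x => (hVo x).mem_nhds (hVx x)
  have hSne : S.Nonempty := by
    by_contra h
    rw [Set.not_nonempty_iff_eq_empty.1 h] at hScov
    simp only [Set.biUnion_empty] at hScov
    exact Set.empty_ne_univ hScov
  obtain ⟨s, rfl⟩ := hS.exists_eq_range hSne
  let orb : ℕ → Set H := fun k => ⋃ γ : Γ, (fun g => (γ : H) * g) ⁻¹' V (s k)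
  have horb : ∀ k, IsOpen (orb k) := fun k =>
    isOpen_iUnion fun γ => (hVo _).preimage (continuous_const_mul _)
  have hmem : ∀ k g, g ∈ orb k ↔ ∃ γ ∈ Γ, γ * g ∈ V (s k) := by
    intro k g; simp [orb]
  have horbinv : ∀ k g, ∀ γ ∈ Γ, γ * g ∈ orb k → g ∈ orb k := by
    intro k g γ hγ h
    obtain ⟨δ, hδ, h⟩ := (hmem _ _).1 h
    exact (hmem _ _).2 ⟨δ * γ, Γ.mul_mem hδ hγ, by rwa [mul_assoc]⟩
  have hcov : ∀ g, ∃ k, g ∈ orb k := by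
    intro g
    have hg : g ∈ ⋃ x ∈ Set.range s, V x := by rw [hScov]; trivial
    simp only [Set.mem_range, Set.iUnion_exists, Set.iUnion_iUnion_eq', Set.mem_iUnion] at hg
    obtain ⟨k, hk⟩ := hg
    exact ⟨k, (hmem _ _).2 ⟨1, Γ.one_mem, by rwa [one_mul]⟩⟩
  refine ⟨⋃ k, V (s k) \ ⋃ j ∈ Set.Iio k, orb j, IsFundamentalDomain.mk'
    (MeasurableSet.nullMeasurableSet ?_) fun g => ?_⟩
  · exact MeasurableSet.iUnion fun k => (hVo _).measurableSet.diff
      (isOpen_biUnion fun j _ => horb j).measurableSet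
  · classical
    set k := Nat.find (hcov g) with hk
    have hlt : ∀ j < k, g ∉ orb j := fun j hj => Nat.find_min (hcov g) hj
    obtain ⟨γ, hγ, hγk⟩ := (hmem _ _).1 (Nat.find_spec (hcov g))
    have honly : ∀ δ : Γ, δ • g ∈ (⋃ k, V (s k) \ ⋃ j ∈ Set.Iio k, orb j) →
        (δ : H) * g ∈ V (s k) := by
      intro δ hδ
      obtain ⟨l, h1, h2⟩ := Set.mem_iUnion.1 hδ
      have h1' : (δ : H) * g ∈ V (s l) := h1
      have hgl : g ∈ orb l := (hmem _ _).2 ⟨δ, δ.2, h1'⟩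
      have hkl : k ≤ l := not_lt.1 fun h => hlt l h hgl
      rcases hkl.lt_or_eq with h | h
      · refine absurd ?_ h2
        refine Set.mem_biUnion (show k ∈ Set.Iio l from h) ((hmem _ _).2 ?_)
        refine ⟨γ * (δ : H)⁻¹, Γ.mul_mem hγ (Γ.inv_mem δ.2), ?_⟩
        rw [Subgroup.smul_def, smul_eq_mul, mul_assoc, inv_mul_cancel_left]
        exact hγk
      · rw [h]; exact h1'
    refine ⟨⟨γ, hγ⟩, Set.mem_iUnion.2 ⟨k, hγk, ?_⟩, fun δ hδ => ?_⟩
    · intro hmem'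
      simp only [Set.mem_iUnion, Set.mem_Iio] at hmem'
      obtain ⟨j, hj, hjm⟩ := hmem'
      exact hlt j hj (horbinv j g γ hγ hjm)
    · have h1 := honly δ hδ
      have h2 := hVinj (s k) (γ * g) (δ * γ⁻¹) (Γ.mul_mem δ.2 (Γ.inv_mem hγ)) hγk
        (by rwa [mul_assoc, inv_mul_cancel_left])
      exact Subtype.ext (mul_inv_eq_one.1 h2)

theorem exists_nhds_Gam (n : ℕ) :
    ∃ W ∈ nhds (1 : G n), ∀ γ ∈ Gam n, γ ∈ W → γ = 1 := by
  have hcont : ∀ i j : Fin n, Continuous fun g : G n => (g : Matrix (Fin n) (Fin n) ℝ) i j :=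
    fun i j => (continuous_apply_apply i j).comp (isClosedEmbedding_entries n).continuous
  refine ⟨⋂ i, ⋂ j, {g : G n | |(g : Matrix (Fin n) (Fin n) ℝ) i j - (1 : Matrix _ _ ℝ) i j| < 1},
    ?_, ?_⟩
  · refine (isOpen_iInter_of_finite fun i => isOpen_iInter_of_finite fun j =>
      isOpen_lt (((hcont i j).sub continuous_const).abs) continuous_const).mem_nhds ?_
    simp
  · rintro _ ⟨γ, rfl⟩ hγ
    have : γ = 1 := by
      apply Subtype.ext
      ext i j
      simp only [Set.mem_iInter, Set.mem_ofPred_eq] at hγ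
      have h := hγ i j
      have h1 : (1 : Matrix (Fin n) (Fin n) ℝ) i j =
          (((1 : Matrix (Fin n) (Fin n) ℤ) i j : ℤ) : ℝ) := by
        simp only [Matrix.one_apply]; split_ifs <;> simp
      have h2 : ((Matrix.SpecialLinearGroup.map (Int.castRingHom ℝ) γ : G n) :
          Matrix (Fin n) (Fin n) ℝ) i j = ((γ : Matrix (Fin n) (Fin n) ℤ) i j : ℝ) := rfl
      rw [h1, h2, ← Int.cast_sub, ← Int.cast_abs] at h
      have h3 : |(γ : Matrix (Fin n) (Fin n) ℤ) i j - (1 : Matrix (Fin n) (Fin n) ℤ) i j| < 1 := by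
        exact_mod_cast h
      exact sub_eq_zero.1 (Int.abs_lt_one_iff.1 h3)
    rw [this, map_one]

instance (n : ℕ) : Countable (Gam n) := by
  have : Countable (Matrix (Fin n) (Fin n) ℤ) :=
    inferInstanceAs (Countable (Fin n → Fin n → ℤ))
  have : Countable (Matrix.SpecialLinearGroup (Fin n) ℤ) :=
    Function.Injective.countable (f := fun γ => (γ : Matrix (Fin n) (Fin n) ℤ))
      Subtype.val_injective
  exact (Set.countable_range
    (Matrix.SpecialLinearGroup.map (n := Fin n) (Int.castRingHom ℝ))).to_subtype

/-- A fundamental domain is no larger than any set that meets every orbit. -/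
theorem measure_fundamentalDomain_le {Γ α : Type*} [Group Γ] [Countable Γ] [MulAction Γ α]
    [MeasurableSpace α] [MeasurableConstSMul Γ α] {μ : Measure α} [SMulInvariantMeasure Γ α μ]
    {F T : Set α} (hF : IsFundamentalDomain Γ F μ) (hT : ∀ x, ∃ γ : Γ, γ • x ∈ T) :
    μ F ≤ μ T := by
  rw [hF.measure_eq_tsum T]
  refine le_trans (measure_mono fun x hx => ?_) (measure_iUnion_le _)
  obtain ⟨γ, hγ⟩ := hT x
  exact Set.mem_iUnion.2 ⟨γ⁻¹, Set.mem_smul_set.2 ⟨_, hγ, inv_smul_smul _ _⟩, hx⟩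

theorem hasFundamentalDomain (n : ℕ) : HasFundamentalDomain (Gam n) (G n) (vol n) := by
  obtain ⟨W, hW, h⟩ := exists_nhds_Gam n
  exact ⟨exists_isFundamentalDomain (Gam n) hW h (vol n)⟩

/-- The Siegel set meets every orbit of right translations by `SL_n(ℤ)`, so its inverse, which has
the same volume, meets every orbit of left translations. -/
theorem quotVol_le_vol_siegel (n : ℕ) [NeZero n] :
    quotVol n ≤ vol n (siegel n (2 / √3) (1 / 2)) := by
  have := isHaarMeasure_vol n
  have := isInvInvariant_vol n
  obtain ⟨F, hF⟩ := (hasFundamentalDomain n).ExistsIsFundamentalDomain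
  rw [quotVol, hF.covolume_eq_volume,
    ← Measure.measure_inv (vol n) (siegel n (2 / √3) (1 / 2))]
  refine measure_fundamentalDomain_le hF fun x => ?_
  obtain ⟨γ, hγ, h⟩ := exists_mul_mem_siegel x⁻¹
  refine ⟨⟨γ⁻¹, (Gam n).inv_mem hγ⟩, ?_⟩
  rw [Set.mem_inv, Subgroup.smul_def, smul_eq_mul, _root_.mul_inv_rev, inv_inv]
  exact h

/-! ### The volume of the Siegel set -/

/-- The bidiagonal matrix of the difference operator `w ↦ (w_k - w_{k+1})_k`, where `w_m = 0`. -/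
def diffMat (m : ℕ) : Matrix (Fin m) (Fin m) ℝ :=
  Matrix.of fun k l => if l = k then 1 else if (l : ℕ) = k + 1 then -1 else 0

theorem det_diffMat (m : ℕ) : (diffMat m).det = 1 := by
  rw [Matrix.det_of_isUpperTriangular]
  · simp [diffMat]
  · intro k l hkl
    have hkl' : l < k := hkl
    have : (l : ℕ) < k := hkl'
    simp only [diffMat, Matrix.of_apply]
    rw [if_neg hkl'.ne, if_neg (by omega)]

theorem diffMat_mulVec_last {m : ℕ} (w : Fin m → ℝ) (k : Fin m) (hk : (k : ℕ) + 1 = m) :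
    (diffMat m *ᵥ w) k = w k := by
  rw [Matrix.mulVec, dotProduct, Finset.sum_eq_single k]
  · simp [diffMat]
  · intro l _ hl
    simp only [diffMat, Matrix.of_apply]
    rw [if_neg hl, if_neg (by have := l.2; omega), zero_mul]
  · simp

theorem diffMat_mulVec_lt {m : ℕ} (w : Fin m → ℝ) (k : Fin m) (hk : (k : ℕ) + 1 < m) :
    (diffMat m *ᵥ w) k = w k - w ⟨k + 1, hk⟩ := by
  have hne : k ≠ ⟨k + 1, hk⟩ := fun h => by
    have := congrArg Fin.val h
    simp at this
  rw [Matrix.mulVec, dotProduct, Finset.sum_eq_add k ⟨k + 1, hk⟩ hne]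
  · simp [diffMat, hne.symm, sub_eq_add_neg]
  · intro l _ hl
    simp only [diffMat, Matrix.of_apply]
    rw [if_neg hl.1, if_neg (fun h => hl.2 (Fin.ext h)), zero_mul]
  · simp
  · simp

/-- The linear map from `(log a_1, …, log a_m)` to the logarithms of the ratios `a_k / a_{k+1}`,
for `a_{m+1} = (a_1 ⋯ a_m)⁻¹`. -/
def ratioMat (m : ℕ) : Matrix (Fin m) (Fin m) ℝ :=
  diffMat m * (1 + Matrix.of fun _ _ => 1)

theorem det_ratioMat (m : ℕ) : (ratioMat m).det = m + 1 := by
  have h : (Matrix.of fun _ _ => 1 : Matrix (Fin m) (Fin m) ℝ) =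
      (Matrix.replicateCol Unit (1 : Fin m → ℝ) : Matrix (Fin m) Unit ℝ) *
        (Matrix.replicateRow Unit (1 : Fin m → ℝ) : Matrix Unit (Fin m) ℝ) := by
    ext i j; simp [Matrix.mul_apply]
  rw [ratioMat, Matrix.det_mul, det_diffMat, h, Matrix.det_one_add_replicateCol_mul_replicateRow]
  simp [add_comm]

/-- The logarithms of the diagonal entries `a_1, …, a_{m+1}`. -/
noncomputable def logEntry {m : ℕ} (t : Fin m → ℝ) : Fin (m + 1) → ℝ :=
  Fin.snoc (α := fun _ => ℝ) t (-∑ j, t j)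

theorem diagEntry_eq_exp {m : ℕ} (t : Fin m → ℝ) (i : Fin (m + 1)) :
    diagEntry (m + 1) t i = Real.exp (logEntry t i) := by
  refine Fin.lastCases ?_ (fun i => ?_) i
  · simp [diagEntry, logEntry]
  · simp [diagEntry, logEntry]

theorem ratioMat_mulVec {m : ℕ} (t : Fin m → ℝ) (k : Fin m) :
    (ratioMat m *ᵥ t) k = logEntry t k.castSucc - logEntry t k.succ := by
  have hw : (1 + Matrix.of fun _ _ => 1 : Matrix (Fin m) (Fin m) ℝ) *ᵥ t =
      fun l => t l + ∑ j, t j := by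
    ext l
    rw [Matrix.add_mulVec, Matrix.one_mulVec]
    simp [Matrix.mulVec, dotProduct]
  rw [ratioMat, ← Matrix.mulVec_mulVec, hw]
  have hcast : logEntry t k.castSucc = t k := by simp [logEntry]
  by_cases hk : (k : ℕ) + 1 < m
  · have hs : k.succ = Fin.castSucc ⟨k + 1, hk⟩ := Fin.ext rfl
    have hsucc : logEntry t k.succ = t ⟨k + 1, hk⟩ := by
      rw [hs, logEntry, Fin.snoc_castSucc]
    rw [diffMat_mulVec_lt _ _ hk, hcast, hsucc]
    ring
  · have hk' : (k : ℕ) + 1 = m := by have := k.2; omega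
    have hs : k.succ = Fin.last m := Fin.ext hk'
    have hsucc : logEntry t k.succ = -∑ j, t j := by rw [hs]; simp [logEntry]
    rw [diffMat_mulVec_last _ _ hk', hcast, hsucc]
    ring

theorem sub_eq_sum_differences {m : ℕ} (α : Fin (m + 1) → ℝ) (i j : Fin (m + 1)) (hij : i ≤ j) :
    α i - α j = ∑ k : Fin m, if i ≤ k.castSucc ∧ k.castSucc < j then
      α k.castSucc - α k.succ else 0 := by
  induction j using Fin.induction with
  | zero =>
    have : i = 0 := le_antisymm hij (Fin.zero_le _)
    simp [this]
  | succ l ih =>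
    rcases hij.eq_or_lt with h | h
    · rw [h, sub_self]
      refine (Finset.sum_eq_zero fun k _ => if_neg fun hk => ?_).symm
      exact absurd hk.2 hk.1.not_gt
    · have hil : i ≤ l.castSucc := by
        rw [Fin.le_def]; rw [Fin.lt_def] at h; simp at h ⊢; omega
      have hpt : ∀ k : Fin m, (if i ≤ k.castSucc ∧ k.castSucc < l.succ then
          α k.castSucc - α k.succ else 0) =
          (if i ≤ k.castSucc ∧ k.castSucc < l.castSucc then α k.castSucc - α k.succ else 0) +
            if k = l then α l.castSucc - α l.succ else 0 := by
        intro k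
        rcases lt_trichotomy k l with hkl | hkl | hkl
        · have h1 : k.castSucc < l.castSucc := hkl
          have h2 : k.castSucc < l.succ := h1.trans (Fin.castSucc_lt_succ)
          simp [h2, hkl, hkl.ne]
        · subst hkl
          simp [hil]
        · have h1 : ¬ k.castSucc < l.castSucc := not_lt.2 (le_of_lt hkl)
          have h2 : ¬ k.castSucc < l.succ := by
            rw [Fin.lt_def]; rw [Fin.lt_def] at hkl; simp; omega
          simp [h2, hkl.not_gt, hkl.ne']
      rw [Finset.sum_congr rfl fun k _ => hpt k, Finset.sum_add_distrib, ← ih hil,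
        Finset.sum_ite_eq']
      simp

/-- The exponent of `a_k / a_{k+1}` in `∏_{i<j} a_i / a_j`: the number of pairs `i ≤ k < j`. -/
def ratioExponent (m : ℕ) (k : Fin m) : ℕ := (k + 1) * (m - k)

theorem ratioExponent_pos {m : ℕ} (k : Fin m) : 0 < ratioExponent m k :=
  Nat.mul_pos (Nat.succ_pos _) (Nat.sub_pos_of_lt k.2)

theorem card_separated_pairs {m : ℕ} (k : Fin m) :
    (Finset.univ.filter fun p : Upper (m + 1) =>
      p.1.1 ≤ k.castSucc ∧ k.castSucc < p.1.2).card = ratioExponent m k := by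
  have h1 : (Finset.univ.filter fun p : Upper (m + 1) =>
      p.1.1 ≤ k.castSucc ∧ k.castSucc < p.1.2).map (Function.Embedding.subtype _) =
      Finset.Iic k.castSucc ×ˢ Finset.Ioi k.castSucc := by
    ext ⟨i, j⟩
    simp only [Finset.mem_map, Finset.mem_filter, Finset.mem_univ, true_and,
      Function.Embedding.subtype_apply, Finset.mem_product, Finset.mem_Iic, Finset.mem_Ioi]
    constructor
    · rintro ⟨p, hp, h⟩
      rw [h] at hp; exact hp
    · rintro ⟨h1, h2⟩
      exact ⟨⟨(i, j), lt_of_le_of_lt h1 h2⟩, ⟨h1, h2⟩, rfl⟩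
  rw [← Finset.card_map, h1, Finset.card_product, Fin.card_Iic, Fin.card_Ioi, ratioExponent]
  simp

theorem density_eq_exp {m : ℕ} (t : Fin m → ℝ) : density (m + 1) t =
    ∏ k, Real.exp (ratioExponent m k * (ratioMat m *ᵥ t) k) := by
  have h1 : ∀ p : Upper (m + 1), diagEntry (m + 1) t p.1.1 / diagEntry (m + 1) t p.1.2 =
      Real.exp (∑ k : Fin m, if p.1.1 ≤ k.castSucc ∧ k.castSucc < p.1.2 then
        (ratioMat m *ᵥ t) k else 0) := by
    intro p
    rw [diagEntry_eq_exp, diagEntry_eq_exp, ← Real.exp_sub,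
      sub_eq_sum_differences _ _ _ p.2.le]
    simp only [ratioMat_mulVec]
  rw [density]
  simp only [h1]
  rw [← Real.exp_sum, ← Real.exp_sum, Finset.sum_comm]
  congr 1
  refine Finset.sum_congr rfl fun k _ => ?_
  rw [← Finset.sum_filter, Finset.sum_const, card_separated_pairs, nsmul_eq_mul]

theorem lintegral_prod_exp {m : ℕ} {c : Fin m → ℝ} (hc : ∀ k, 0 < c k) (a : ℝ) :
    ∫⁻ s in Set.univ.pi fun _ : Fin m => Set.Iic a, ENNReal.ofReal (∏ k, Real.exp (c k * s k)) =
      ENNReal.ofReal (∏ k, (Real.exp (c k * a) / c k)) := by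
  have hint : ∀ k, Integrable (fun x => Real.exp (c k * x)) (volume.restrict (Set.Iic a)) :=
    fun k => integrableOn_exp_mul_Iic (hc k) a
  rw [volume_pi, Measure.restrict_pi_pi, ← ofReal_integral_eq_lintegral_ofReal
    (Integrable.fintype_prod hint)
    (Filter.Eventually.of_forall fun s => Finset.prod_nonneg fun k _ => (Real.exp_pos _).le)]
  rw [integral_fintype_prod_eq_prod (f := fun k x => Real.exp (c k * x))]
  simp only [integral_exp_mul_Iic (hc _)]

/-- The volume of `A_τ` for the measure `∏_{i<j} (a_i / a_j) da`. The logarithms of the ratios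
`a_k / a_{k+1}` are linear coordinates of determinant `m + 1` in which the integral is a product. -/
theorem measA_ratio_le (m : ℕ) (a : ℝ) :
    measA (m + 1) {t : Fin m → ℝ | ∀ k, (ratioMat m *ᵥ t) k ≤ a} =
      ENNReal.ofReal ((m + 1 : ℝ)⁻¹ *
        ∏ k, (Real.exp (ratioExponent m k * a) / ratioExponent m k)) := by
  have hdet : (0 : ℝ) < m + 1 := by positivity
  have hmap := Real.map_matrix_volume_pi_eq_smul_volume_pi (M := ratioMat m)
    (by rw [det_ratioMat]; exact hdet.ne')
  have hS : MeasurableSet (Set.univ.pi fun _ : Fin m => Set.Iic a) :=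
    MeasurableSet.univ_pi fun _ => measurableSet_Iic
  have hL : Measurable (Matrix.toLin' (ratioMat m)) :=
    (Matrix.toLin' (ratioMat m)).continuous_of_finiteDimensional.measurable
  have hset : {t : Fin m → ℝ | ∀ k, (ratioMat m *ᵥ t) k ≤ a} =
      Matrix.toLin' (ratioMat m) ⁻¹' (Set.univ.pi fun _ : Fin m => Set.Iic a) := by
    ext t
    simp only [Set.mem_ofPred_eq, Set.mem_preimage, Set.mem_univ_pi, Set.mem_Iic,
      Matrix.toLin'_apply]
  have hg : Measurable fun s : Fin m → ℝ =>
      ENNReal.ofReal (∏ k, Real.exp (ratioExponent m k * s k)) := by fun_prop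
  rw [hset, measA]
  refine (withDensity_apply _ (hL hS)).trans ?_
  have h1 := setLIntegral_map (μ := volume) hS hg hL
  rw [hmap, Measure.restrict_smul, lintegral_smul_measure, lintegral_prod_exp
    (fun k => by exact_mod_cast ratioExponent_pos k), det_ratioMat, abs_of_pos (inv_pos.2 hdet),
    smul_eq_mul, ← ENNReal.ofReal_mul (inv_pos.2 hdet).le] at h1
  rw [h1]
  refine lintegral_congr fun t => ?_
  exact congrArg ENNReal.ofReal (density_eq_exp t)

/-- The Siegel set in Iwasawa coordinates. -/
theorem preimage_siegel (m : ℕ) {τ : ℝ} (hτ : 0 < τ) (l : ℝ) :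
    iwasawaEquiv (m + 1) ⁻¹' siegel (m + 1) τ l =
      Set.univ ×ˢ ({t : Fin m → ℝ | ∀ k, (ratioMat m *ᵥ t) k ≤ Real.log τ} ×ˢ
        {u : Upper (m + 1) → ℝ | ∀ p, |u p| ≤ l}) := by
  have hratio : ∀ t : Fin m → ℝ, (∀ k, (ratioMat m *ᵥ t) k ≤ Real.log τ) ↔
      ∀ i j : Fin (m + 1), (j : ℕ) = i + 1 →
        diagEntry (m + 1) t i / diagEntry (m + 1) t j ≤ τ := by
    intro t
    have h1 : ∀ k : Fin m, (ratioMat m *ᵥ t) k ≤ Real.log τ ↔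
        diagEntry (m + 1) t k.castSucc / diagEntry (m + 1) t k.succ ≤ τ := by
      intro k
      rw [ratioMat_mulVec, diagEntry_eq_exp, diagEntry_eq_exp, ← Real.exp_sub,
        Real.le_log_iff_exp_le hτ]
    constructor
    · intro h i j hij
      have hi : (i : ℕ) < m := by have := j.2; omega
      have hii : i = Fin.castSucc ⟨i, hi⟩ := rfl
      have hjj : j = Fin.succ ⟨i, hi⟩ := Fin.ext hij
      rw [hii, hjj]
      exact (h1 _).1 (h _)
    · intro h k
      exact (h1 k).2 (h _ _ (by simp))
  ext ⟨k, t, u⟩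
  have happ : iwasawaEquiv (m + 1) (k, t, u) = (k : G (m + 1)) * (matA (m + 1) t * matN (m + 1) u) :=
    rfl
  simp only [Set.mem_preimage, Set.mem_prod, Set.mem_univ, true_and, Set.mem_ofPred_eq, happ]
  rw [hratio]
  constructor
  · rintro ⟨_, ⟨k', hk', a, ⟨d, hd, had, hdr⟩, rfl⟩, v, ⟨hv1, hv2, hv3⟩, h⟩
    obtain ⟨t', ht', rfl⟩ := exists_matA_eq a hd had
    have hv := exists_matN_eq hv1 hv2
    rw [← hv] at h
    have hinj := (iwasawa_bijective (m + 1)).1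
      (a₁ := (⟨k', hk'⟩, t', fun p => v p.1.1 p.1.2)) (a₂ := (k, t, u))
      (by
        show k' * (matA (m + 1) t' * matN (m + 1) _) = _
        rw [← mul_assoc]; exact h)
    obtain ⟨-, h2⟩ := Prod.ext_iff.1 hinj
    obtain ⟨rfl, rfl⟩ := Prod.ext_iff.1 h2
    refine ⟨fun i j hij => ?_, fun p => hv3 _ _ p.2⟩
    simp only [ht']
    exact hdr i j hij
  · rintro ⟨h1, h2⟩
    rw [← mul_assoc]
    refine Set.mul_mem_mul (Set.mul_mem_mul k.2 ⟨_, diagEntry_pos _ t, coe_matA _ t, h1⟩)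
      ⟨fun i => matN_apply_self u i, fun i j hij => matN_apply_gt u hij, fun i j hij => ?_⟩
    have h3 := matN_apply_lt u (⟨(i, j), hij⟩ : Upper (m + 1))
    exact (congrArg abs h3).trans_le (h2 _)

/-- The volume of the Siegel set `Σ_{2/√3, 1/2}` of `SL_{m+1}(ℝ)`. -/
noncomputable def siegelVolume (m : ℕ) : ℝ :=
  volSO (m + 1) * ((m + 1 : ℝ)⁻¹ *
    ∏ k, (Real.exp (ratioExponent m k * Real.log (2 / √3)) / ratioExponent m k))

theorem vol_siegel (m : ℕ) :
    vol (m + 1) (siegel (m + 1) (2 / √3) (1 / 2)) = ENNReal.ofReal (siegelVolume m) := by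
  have hbox : (volume : Measure (Upper (m + 1) → ℝ))
      {u : Upper (m + 1) → ℝ | ∀ p, |u p| ≤ 1 / 2} = 1 := by
    have : {u : Upper (m + 1) → ℝ | ∀ p, |u p| ≤ 1 / 2} =
        Set.univ.pi fun _ => Set.Icc (-(1 / 2)) (1 / 2) := by
      ext u; simp only [Set.mem_ofPred_eq, Set.mem_univ_pi, Set.mem_Icc, abs_le]
    rw [this, volume_pi_pi]
    norm_num [Real.volume_Icc]
  rw [vol_eq_map, (iwasawaEquiv (m + 1)).map_apply, preimage_siegel m (by positivity),
    Measure.prod_prod, muK_univ, measB]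
  refine (congrArg _ (Measure.prod_prod _ _)).trans ?_
  rw [hbox, mul_one, siegelVolume, ENNReal.ofReal_mul (volSO_pos _).le]
  exact congrArg _ (measA_ratio_le m _)

/-! ### Asymptotics of the volume -/

/-- The factor `2^{(i-1)/2} vol(S^{i-1})` of `vol(SO_n)`. -/
noncomputable def sphereFactor (i : ℕ) : ℝ := (2 : ℝ) ^ (((i : ℝ) - 1) / 2) * sphereVol i

theorem sphereFactor_add_two {i : ℕ} (hi : i ≠ 0) :
    sphereFactor (i + 2) = sphereFactor i * (4 * Real.pi / i) := by
  have hi' : (0 : ℝ) < i := by positivity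
  have h1 : ((i + 2 : ℕ) : ℝ) / 2 = (i : ℝ) / 2 + 1 := by push_cast; ring
  have h2 : (((i + 2 : ℕ) : ℝ) - 1) / 2 = ((i : ℝ) - 1) / 2 + 1 := by push_cast; ring
  have hG := (Real.Gamma_pos_of_pos (half_pos hi')).ne'
  rw [sphereFactor, sphereFactor, sphereVol, sphereVol, h1, h2, Real.rpow_add_one two_ne_zero,
    Real.rpow_add_one Real.pi_ne_zero, Real.Gamma_add_one (half_pos hi').ne']
  field_simp
  ring

theorem sphereFactor_nonneg (i : ℕ) : 0 ≤ sphereFactor i := by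
  have := Real.Gamma_nonneg_of_nonneg (s := (i : ℝ) / 2) (by positivity)
  unfold sphereFactor sphereVol
  positivity

/-- The factors of `vol(SO_n)` are bounded: the ratio `4π / i` of the factors `i + 2` and `i` is at
most one as soon as `i ≥ 13`. -/
theorem exists_sphereFactor_le : ∃ R : ℝ, 1 ≤ R ∧ ∀ i, sphereFactor i ≤ R := by
  have hnn : 0 ≤ ∑ i ∈ Finset.range 16, sphereFactor i :=
    Finset.sum_nonneg fun i _ => sphereFactor_nonneg i
  refine ⟨1 + ∑ i ∈ Finset.range 16, sphereFactor i, by linarith, fun i => ?_⟩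
  induction i using Nat.strong_induction_on with
  | _ i ih =>
    rcases lt_or_ge i 16 with h | h
    · have := Finset.single_le_sum (f := sphereFactor) (fun i _ => sphereFactor_nonneg i)
        (Finset.mem_range.2 h)
      linarith
    · obtain ⟨j, rfl⟩ : ∃ j, i = j + 2 := ⟨i - 2, by omega⟩
      rw [sphereFactor_add_two (by omega)]
      have hj : (14 : ℝ) ≤ j := by exact_mod_cast (by omega : 14 ≤ j)
      have h1 : 4 * Real.pi / j ≤ 1 := by
        rw [div_le_one (by linarith)]
        linarith [Real.pi_lt_d2]
      exact (mul_le_of_le_one_right (sphereFactor_nonneg j) h1).trans (ih j (by omega))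

theorem Gamma_half_le {i : ℕ} (hi : 2 ≤ i) : Real.Gamma ((i : ℝ) / 2) ≤ (i : ℝ) ^ i := by
  induction i using Nat.strong_induction_on with
  | _ i ih =>
    rcases lt_or_ge i 4 with h | h
    · interval_cases i
      · norm_num
      · have h1 : ((3 : ℕ) : ℝ) / 2 = 1 / 2 + 1 := by norm_num
        rw [h1, Real.Gamma_add_one (by norm_num), Real.Gamma_one_half_eq]
        have h2 : √Real.pi ≤ 2 := Real.sqrt_le_iff.2 ⟨by norm_num, by linarith [Real.pi_le_four]⟩
        norm_num
        linarith
    · obtain ⟨j, rfl⟩ : ∃ j, i = j + 2 := ⟨i - 2, by omega⟩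
      have hj : (0 : ℝ) < j := by exact_mod_cast (by omega : 0 < j)
      have h1 : ((j + 2 : ℕ) : ℝ) / 2 = (j : ℝ) / 2 + 1 := by push_cast; ring
      rw [h1, Real.Gamma_add_one (half_pos hj).ne']
      calc (j : ℝ) / 2 * Real.Gamma ((j : ℝ) / 2) ≤ (j : ℝ) / 2 * (j : ℝ) ^ j := by
            gcongr; exact ih j (by omega) (by omega)
        _ ≤ ((j + 2 : ℕ) : ℝ) ^ 2 * ((j + 2 : ℕ) : ℝ) ^ j := by
            push_cast
            gcongr
            · nlinarith
            · linarith
        _ = ((j + 2 : ℕ) : ℝ) ^ (j + 2) := by ring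

theorem sphereFactor_pos {i : ℕ} (hi : 2 ≤ i) : 0 < sphereFactor i :=
  mul_pos (by positivity) (sphereVol_pos (by omega))

theorem log_sphereFactor_ge {i : ℕ} (hi : 2 ≤ i) : -(i * Real.log i) ≤ Real.log (sphereFactor i) := by
  have hi' : (2 : ℝ) ≤ i := by exact_mod_cast hi
  have hG : 0 < Real.Gamma ((i : ℝ) / 2) := Real.Gamma_pos_of_pos (by linarith)
  have h1 : 1 / (i : ℝ) ^ i ≤ sphereFactor i := by
    have h2 : (1 : ℝ) ≤ (2 : ℝ) ^ (((i : ℝ) - 1) / 2) :=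
      Real.one_le_rpow one_le_two (by linarith)
    have h3 : (1 : ℝ) ≤ Real.pi ^ ((i : ℝ) / 2) :=
      Real.one_le_rpow (by linarith [Real.pi_gt_three]) (by linarith)
    calc 1 / (i : ℝ) ^ i ≤ 1 / Real.Gamma ((i : ℝ) / 2) :=
          one_div_le_one_div_of_le hG (Gamma_half_le hi)
      _ ≤ sphereVol i := by
          unfold sphereVol
          gcongr
          linarith
      _ ≤ sphereFactor i :=
          le_mul_of_one_le_left (sphereVol_pos (by omega)).le h2
  have h4 := Real.log_le_log (by positivity) h1
  rwa [one_div, Real.log_inv, Real.log_pow] at h4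

theorem volSO_le {R : ℝ} (hR : ∀ i, sphereFactor i ≤ R) (m : ℕ) : volSO (m + 1) ≤ R ^ m := by
  have h := Finset.prod_le_prod (s := Finset.Icc 2 (m + 1)) (f := sphereFactor) (g := fun _ => R)
    (fun i _ => sphereFactor_nonneg i) (fun i _ => hR i)
  rw [Finset.prod_const, Nat.card_Icc, show m + 1 + 1 - 2 = m by omega] at h
  exact h

theorem log_volSO_ge (m : ℕ) :
    -((m + 1 : ℝ) ^ 2 * Real.log (m + 1)) ≤ Real.log (volSO (m + 1)) := by
  have h1 : Real.log (volSO (m + 1)) = ∑ i ∈ Finset.Icc 2 (m + 1), Real.log (sphereFactor i) :=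
    Real.log_prod fun i hi => (sphereFactor_pos (Finset.mem_Icc.1 hi).1).ne'
  have hlog : 0 ≤ Real.log (m + 1 : ℝ) := Real.log_nonneg (by linarith [m.cast_nonneg (α := ℝ)])
  have h2 : ∀ i ∈ Finset.Icc 2 (m + 1),
      -((m + 1 : ℝ) * Real.log (m + 1)) ≤ Real.log (sphereFactor i) := by
    intro i hi
    obtain ⟨hi1, hi2⟩ := Finset.mem_Icc.1 hi
    refine le_trans (neg_le_neg ?_) (log_sphereFactor_ge hi1)
    have hi3 : (i : ℝ) ≤ m + 1 := by exact_mod_cast hi2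
    have hi4 : (0 : ℝ) < i := by positivity
    gcongr
  have h3 := Finset.card_nsmul_le_sum _ _ _ h2
  rw [Nat.card_Icc, nsmul_eq_mul] at h3
  rw [h1]
  refine le_trans ?_ h3
  have hm : ((m + 1 + 1 - 2 : ℕ) : ℝ) ≤ m + 1 := by exact_mod_cast (by omega)
  nlinarith [mul_nonneg (by positivity : (0 : ℝ) ≤ m + 1) hlog]

theorem sum_ratioExponent (m : ℕ) :
    (∑ k, (ratioExponent m k : ℝ)) = m * (m + 1) * (m + 2) / 6 := by
  have h : ∀ k : Fin m, (ratioExponent m k : ℝ) = ((k : ℕ) + 1 : ℝ) * (m - (k : ℕ)) := by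
    intro k
    rw [ratioExponent, Nat.cast_mul, Nat.cast_sub k.2.le]
    push_cast; ring
  have hsum : ∀ l : ℕ, ∑ k ∈ Finset.range l, ((k : ℝ) + 1) * (m - k) =
      l * (l + 1) * (3 * m - 2 * l + 2) / 6 := by
    intro l
    induction l with
    | zero => simp
    | succ l ih => rw [Finset.sum_range_succ, ih]; push_cast; ring
  rw [Finset.sum_congr rfl fun k _ => h k,
    Fin.sum_univ_eq_sum_range (fun k : ℕ => ((k : ℝ) + 1) * (m - k)) m, hsum]
  ring

/-- The growth rate `log(2/√3) / 6` of `log vol(Σ^{(n)}) / n³`. -/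
noncomputable def growthRate : ℝ := Real.log (2 / √3) / 6

theorem growthRate_pos : 0 < growthRate := by
  refine div_pos (Real.log_pos ?_) (by norm_num)
  rw [one_lt_div (by positivity), Real.sqrt_lt' (by norm_num)]
  norm_num

theorem siegelVolume_eq (m : ℕ) : siegelVolume m =
    volSO (m + 1) * (m + 1 : ℝ)⁻¹ * (∏ k, (ratioExponent m k : ℝ))⁻¹ *
      Real.exp (growthRate * ((m + 1) ^ 3 - (m + 1))) := by
  rw [siegelVolume, Finset.prod_div_distrib, ← Real.exp_sum, ← Finset.sum_mul, sum_ratioExponent,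
    growthRate]
  rw [show (m * (m + 1) * (m + 2) / 6 : ℝ) * Real.log (2 / √3) =
    Real.log (2 / √3) / 6 * ((m + 1) ^ 3 - (m + 1)) by ring]
  ring

theorem factorial_le_prod_ratioExponent (m : ℕ) :
    (m.factorial : ℝ) ≤ ∏ k, (ratioExponent m k : ℝ) := by
  rw [← Finset.prod_range_add_one_eq_factorial, ← Fin.prod_univ_eq_prod_range]
  push_cast
  refine Finset.prod_le_prod (fun k _ => by positivity) fun k _ => ?_
  have : (k : ℕ) + 1 ≤ ratioExponent m k :=
    Nat.le_mul_of_pos_right _ (Nat.sub_pos_of_lt k.2)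
  exact_mod_cast this

theorem siegelVolume_le {R : ℝ} (hR1 : 1 ≤ R) (hR : ∀ i, sphereFactor i ≤ R) (m : ℕ) :
    siegelVolume m ≤ Real.exp R * Real.exp (growthRate * (m + 1) ^ 3) := by
  have hfac : (0 : ℝ) < m.factorial := by exact_mod_cast m.factorial_pos
  have h1 : volSO (m + 1) * (m + 1 : ℝ)⁻¹ * (∏ k, (ratioExponent m k : ℝ))⁻¹ ≤ Real.exp R := by
    calc volSO (m + 1) * (m + 1 : ℝ)⁻¹ * (∏ k, (ratioExponent m k : ℝ))⁻¹
        ≤ R ^ m * 1 * (m.factorial : ℝ)⁻¹ := by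
          have h2 : (m + 1 : ℝ)⁻¹ ≤ 1 := inv_le_one_of_one_le₀ (by simp)
          have h3 := volSO_le hR m
          have h4 := (volSO_pos (m + 1)).le
          have h5 := factorial_le_prod_ratioExponent m
          gcongr
      _ = R ^ m / m.factorial := by rw [mul_one, div_eq_mul_inv]
      _ ≤ Real.exp R := Real.pow_div_factorial_le_exp R (by linarith) m
  rw [siegelVolume_eq]
  have hg := growthRate_pos.le
  gcongr
  have : (0 : ℝ) ≤ m := m.cast_nonneg
  linarith

theorem siegelVolume_pos (m : ℕ) : 0 < siegelVolume m := by
  have h1 := volSO_pos (m + 1)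
  have h2 : 0 < ∏ k, (ratioExponent m k : ℝ) :=
    Finset.prod_pos fun k _ => by exact_mod_cast ratioExponent_pos k
  rw [siegelVolume_eq]
  positivity

theorem abs_log_siegelVolume_sub_le {R : ℝ} (hR1 : 1 ≤ R) (hR : ∀ i, sphereFactor i ≤ R) (m : ℕ) :
    |Real.log (siegelVolume m) - growthRate * (m + 1) ^ 3| ≤
      4 * ((m + 1 : ℝ) ^ 2 * Real.log (m + 1)) + (R + growthRate) * (m + 1) := by
  have hm0 : (0 : ℝ) ≤ m := m.cast_nonneg
  have hlog : 0 ≤ Real.log (m + 1 : ℝ) := Real.log_nonneg (by linarith)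
  have hg := growthRate_pos
  have hmul : (m + 1 : ℝ) * Real.log (m + 1) ≤ (m + 1 : ℝ) ^ 2 * Real.log (m + 1) := by
    gcongr; nlinarith
  have hmul' : Real.log (m + 1) ≤ (m + 1 : ℝ) * Real.log (m + 1) := by nlinarith
  rw [abs_le]
  constructor
  · have hc : 0 < ∏ k, (ratioExponent m k : ℝ) :=
      Finset.prod_pos fun k _ => by exact_mod_cast ratioExponent_pos k
    have hv := volSO_pos (m + 1)
    have hm : (0 : ℝ) < (m + 1 : ℝ)⁻¹ := by positivity
    have hprod : Real.log (∏ k, (ratioExponent m k : ℝ)) ≤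
        2 * ((m + 1 : ℝ) * Real.log (m + 1)) := by
      rw [Real.log_prod fun k _ => by exact_mod_cast (ratioExponent_pos k).ne']
      have h1 : ∀ k ∈ (Finset.univ : Finset (Fin m)), Real.log (ratioExponent m k : ℝ) ≤
          2 * Real.log (m + 1) := by
        intro k _
        have h2 : ratioExponent m k ≤ (m + 1) ^ 2 := by
          rw [ratioExponent, sq]
          exact Nat.mul_le_mul (by have := k.2; omega) (by omega)
        have h3 : (ratioExponent m k : ℝ) ≤ (m + 1) ^ 2 := by exact_mod_cast h2
        have h4 := Real.log_le_log (by exact_mod_cast ratioExponent_pos k) h3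
        rwa [Real.log_pow] at h4
      have h5 := Finset.sum_le_card_nsmul _ _ _ h1
      rw [Finset.card_univ, Fintype.card_fin, nsmul_eq_mul] at h5
      nlinarith
    rw [siegelVolume_eq, Real.log_mul (by positivity) (by positivity),
      Real.log_mul (by positivity) (by positivity), Real.log_mul hv.ne' hm.ne', Real.log_exp,
      Real.log_inv, Real.log_inv]
    nlinarith [log_volSO_ge m]
  · have h1 := Real.log_le_log (siegelVolume_pos m) (siegelVolume_le hR1 hR m)
    rw [Real.log_mul (by positivity) (by positivity), Real.log_exp, Real.log_exp] at h1
    nlinarith [mul_nonneg (by positivity : (0 : ℝ) ≤ (m + 1) ^ 2) hlog]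

theorem tendsto_log_siegelVolume :
    Filter.Tendsto (fun m : ℕ => Real.log (siegelVolume m) / ((m + 1 : ℕ) : ℝ) ^ 3)
      Filter.atTop (nhds growthRate) := by
  obtain ⟨R, hR1, hR⟩ := exists_sphereFactor_le
  rw [tendsto_iff_norm_sub_tendsto_zero]
  have hcast : Filter.Tendsto (fun m : ℕ => ((m + 1 : ℕ) : ℝ)) Filter.atTop Filter.atTop :=
    tendsto_natCast_atTop_atTop.comp (Filter.tendsto_add_atTop_nat 1)
  have h1 : Filter.Tendsto (fun m : ℕ => Real.log ((m + 1 : ℕ) : ℝ) / ((m + 1 : ℕ) : ℝ))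
      Filter.atTop (nhds 0) := Real.isLittleO_log_id_atTop.tendsto_div_nhds_zero.comp hcast
  have h2 : Filter.Tendsto (fun m : ℕ => (((m + 1 : ℕ) : ℝ) ^ 2)⁻¹) Filter.atTop (nhds 0) :=
    ((Filter.tendsto_pow_atTop two_ne_zero).comp hcast).inv_tendsto_atTop
  have h3 := (h1.const_mul 4).add (h2.const_mul (R + growthRate))
  rw [mul_zero, mul_zero, add_zero] at h3
  refine squeeze_zero (fun m => norm_nonneg _) (fun m => ?_) h3
  have hpos : (0 : ℝ) < (m + 1 : ℝ) := by positivity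
  have h4 := abs_log_siegelVolume_sub_le hR1 hR m
  push_cast
  rw [Real.norm_eq_abs, div_sub' (by positivity), abs_div, abs_of_pos (by positivity :
    (0 : ℝ) < (m + 1 : ℝ) ^ 3), div_le_iff₀ (by positivity), mul_comm (((m : ℝ) + 1) ^ 3)]
  refine h4.trans (le_of_eq ?_)
  field_simp

end SLVolume

theorem corollary4p1 :
    (∀ n : ℕ, 2 ≤ n →
      (SLVolume.vol n).IsHaarMeasure ∧
      MeasureTheory.HasFundamentalDomain (SLVolume.Gam n) (SLVolume.G n) (SLVolume.vol n) ∧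
      SLVolume.quotVol n < ⊤ ∧
      SLVolume.quotVol n ≤ SLVolume.vol n (SLVolume.siegel n (2 / Real.sqrt 3) (1 / 2)) ∧
      SLVolume.vol n (SLVolume.siegel n (2 / Real.sqrt 3) (1 / 2)) < ⊤) ∧
    ∃ c : ℝ, 0 < c ∧
      Filter.Tendsto
        (fun n : ℕ =>
          Real.log (SLVolume.vol n (SLVolume.siegel n (2 / Real.sqrt 3) (1 / 2))).toReal
            / (n : ℝ) ^ 3)
        Filter.atTop (nhds c) ∧
      ∃ C : ℝ, 0 < C ∧ ∀ᶠ n : ℕ in Filter.atTop,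
        (SLVolume.quotVol n).toReal ≤ C * Real.exp (c * (n : ℝ) ^ 3) := by
  refine ⟨fun n hn => ?_, SLVolume.growthRate, SLVolume.growthRate_pos, ?_, ?_⟩
  · obtain ⟨m, rfl⟩ : ∃ m, n = m + 1 := ⟨n - 1, by omega⟩
    have hfin : SLVolume.vol (m + 1) (SLVolume.siegel (m + 1) (2 / √3) (1 / 2)) < ⊤ := by
      rw [SLVolume.vol_siegel]; exact ENNReal.ofReal_lt_top
    have hle := SLVolume.quotVol_le_vol_siegel (m + 1)
    exact ⟨SLVolume.isHaarMeasure_vol _, SLVolume.hasFundamentalDomain _, hle.trans_lt hfin, hle,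
      hfin⟩
  · rw [← Filter.tendsto_add_atTop_iff_nat 1]
    simp only [SLVolume.vol_siegel, ENNReal.toReal_ofReal (SLVolume.siegelVolume_pos _).le]
    exact SLVolume.tendsto_log_siegelVolume
  · obtain ⟨R, hR1, hR⟩ := SLVolume.exists_sphereFactor_le
    refine ⟨Real.exp R, Real.exp_pos R, Filter.eventually_atTop.2 ⟨1, fun n hn => ?_⟩⟩
    obtain ⟨m, rfl⟩ : ∃ m, n = m + 1 := ⟨n - 1, by omega⟩
    have hle := SLVolume.quotVol_le_vol_siegel (m + 1)
    rw [SLVolume.vol_siegel] at hle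
    have h1 := ENNReal.toReal_mono ENNReal.ofReal_ne_top hle
    rw [ENNReal.toReal_ofReal (SLVolume.siegelVolume_pos m).le] at h1
    push_cast
    exact h1.trans (SLVolume.siegelVolume_le hR1 hR m)
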